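/- Let $\{\xi_{n,j},\varepsilon_n : n,j\ge 1\}$ be independent random variables with values in $\{0,1,2,\dots\}$ such that, for each $n$, the variables $\xi_{n,1},\xi_{n,2},\dots$ all have the same distribution as a variable $\xi_n$. Define $Y_0=0$ and \[ Y_n=\sum_{j=1}^{Y_{n-1}}\xi_{n,j}+\varepsilon_n,\qquad n\ge 1 . \] Let $f_n(s)=\mathbf E\,s^{\xi_n}$, so that, as elements of $[0,\infty]$, $\overline f_n:=f_n'(1)=\mathbf E\,\xi_n$, $f_n''(1)=\mathbf E[\xi_n(\xi_n-1)]$ and $f_n'''(1)=\mathbf E[\xi_n(\xi_n-1)(\xi_n-2)]$; and let $m_{n,k}=\mathbf E[\varepsilon_n(\varepsilon_n-1)\cdots(\varepsilon_n-k+1)]\in[0,\infty]$. Assume: (C1) $\overline f_n<1$ for all $n\ge1$, $\lim_{n\to\infty}\overline f_n=1$ and $\sum_{n=1}^\infty(1-\overline f_n)=\infty$; (C2) $\lim_{n\to\infty} f_n''(1)/(1-\overline f_n)=\nu\in[0,\infty)$; (C3) if $\nu>0$, then $\lim_{n\to\infty} f_n'''(1)/(1-\overline f_n)=0$; (C4')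 for every $k\ge1$, $\lim_{n\to\infty} \frac{m_{n,k}}{k!\,(1-\overline f_n)}=\lambda_k\in[0,\infty)$, and $\limsup_{n\to\infty}\lambda_n^{1/n}\le 1$. Then $Y_n$ converges in distribution, as $n\to\infty$, to a random variable $Y$ with a compound-Poisson distribution (that is, $Y$ is distributed as $\sum_{i=1}^N Z_i$ with $N$ Poisson and $Z_1,Z_2,\dots$ i.i.d. with values in $\{0,1,2,\dots\}$ and independent of $N$), whose generating function is \[ \mathbf E\,s^{Y}=\exp\left\{-\sum_{k=1}^{\infty}\frac{2^k\lambda_k}{\nu^k}\left(\log\Bigl(1+\frac{\nu}{2}(1-s)\Bigr)+\sum_{i=1}^{k-1}(-1)^i\frac{\nu^i}{i\,2^i}(1-s)^i\right)\right\}. \] If $\nu=0$, the $k$-th term of the outer sum is understood as its limit for $\nu\downarrow0$, namely $(-1)^{k+1}\lambda_k(1-s)^k/k$. The series over $k$ converges absolutely for every $s\in(0,1]$, and the formula holds for these $s$; it also holds at $s=0$ whenever the series converges there (with $0^0=1$). -/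

import Mathlib

open MeasureTheory ProbabilityTheory Filter Topology
open scoped NNReal ENNReal

/-- The `k`-th factorial moment `E[X (X - 1) ⋯ (X - k + 1)]`, with values in `[0, ∞]`, of a
random variable `X` with values in `ℕ`. It is also the `k`-th (left) derivative at `1` of the
generating function `s ↦ E[s ^ X]`. -/
noncomputable def factorialMoment {Ω : Type*} [MeasurableSpace Ω] (P : Measure Ω)
    (X : Ω → ℕ) (k : ℕ) : ℝ≥0∞ :=
  ∫⁻ ω, ((X ω).descFactorial k : ℝ≥0∞) ∂P

/-- The branching process in varying environment with immigration, started at `0`.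
Generations are numbered from `1` while sequences in Lean start at `0`: the variables `ξ n j`
and `ε n` are the offspring numbers and the immigration that produce generation `n + 1`. -/
def branchingImmigration {Ω : Type*} (ξ : ℕ → ℕ → Ω → ℕ) (ε : ℕ → Ω → ℕ) : ℕ → Ω → ℕ
  | 0 => fun _ => 0
  | n + 1 => fun ω => (∑ j ∈ Finset.range (branchingImmigration ξ ε n ω), ξ n j ω) + ε n ω

/-- A measure on `ℕ` is compound Poisson if it is the law of `∑_{i < N} Z i`, where `N` is
Poisson distributed, the `Z i` are identically distributed with values in `ℕ`, and
`N, Z 0, Z 1, …` are independent. -/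
def IsCompoundPoisson (μ : Measure ℕ) : Prop :=
  ∃ (Ω : Type) (_ : MeasurableSpace Ω) (P : Measure Ω) (N : Ω → ℕ) (Z : ℕ → Ω → ℕ) (r : ℝ≥0),
    IsProbabilityMeasure P ∧ Measurable N ∧ (∀ i, Measurable (Z i)) ∧
    iIndepFun (fun o : Option ℕ => o.elim N Z) P ∧
    (∀ i, IdentDistrib (Z i) (Z 0) P P) ∧
    P.map N = poissonMeasure r ∧
    μ = P.map (fun ω => ∑ i ∈ Finset.range (N ω), Z i ω)

/-- For `k ≥ 1` and `ν > 0`, the coefficient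
`(2 / ν) ^ k * (log (1 + ν (1 - s) / 2) + ∑_{i = 1}^{k - 1} (-1) ^ i ν ^ i (1 - s) ^ i / (i 2 ^ i))`
of the `k`-th parameter in `- log` of the limiting generating function; for `ν = 0` its limit
as `ν` decreases to `0`. -/
noncomputable def limitTerm (ν : ℝ) (k : ℕ) (s : ℝ) : ℝ :=
  if ν = 0 then (-1) ^ (k + 1) * (1 - s) ^ k / k
  else 2 ^ k / ν ^ k *
    (Real.log (1 + ν / 2 * (1 - s)) +
      ∑ i ∈ Finset.Ico 1 k, (-1) ^ i * (ν ^ i / (i * 2 ^ i)) * (1 - s) ^ i)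

/-! Work with `y = 1 - s` and with `coGen` in place of generating functions. Sorting the population
by the generation in which its ancestors immigrated gives `E s^{Y_n} = ∏_{j<n} (1 - z_j(u_{n,j}))`.
Here `z_j` is the `coGen` of the immigration and `u_{n,j}` is the point of the backward orbit of `y`
under the offspring maps `h_j`. With `δ_j = 1 - E ξ_j`, the moment conditions say that `h_j` moves
`u` down by about `δ_j (u + ν u² / 2)`. Hence `∑_j δ_j u_{n,j}^{k+1}` behaves like a Riemann sum for
the integral of `t^k / (1 + ν t / 2)` over `[0, y]`, which up to sign is the coefficient of
`λ_{k+1}` (`NearCritical.tendsto_sum_mul_backIter_pow`).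

The immigration laws need not have convergent moment expansions, and a given moment may be infinite
for finitely many `j`. What survives is the sign of the remainder: by the Bonferroni inequalities,
truncated factorial moment expansions bound `z_j` alternately from above and below. So `Q_n(s) = ∑_j
z_j(u_{n,j})` is asymptotically bracketed by consecutive partial sums of the series in the theorem,
and wherever that series converges the brackets close (`eq_of_alternating_bracket`). Since `∑_j
z_j(u_{n,j})²` tends to `0`, the product is asymptotically `exp(-Q_n(s))`.

That the limit is compound Poisson comes from `Q_n(s) = ∑_i p_n(i) (1 - s^i)` with `p_n ≥ 0`, the
exponent of a compound Poisson law. The first bracket bounds `Q_n(s)` asymptotically by `λ_1 (1 -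
s)`, so no mass escapes to infinity and every ultrafilter limit has the same form
(`exists_levy_limit`). This works at `s = 0` too, so the formula there needs no Abelian argument. -/

/-- The probability generating function `E[s ^ X]` of an `ℕ`-valued random variable. -/
noncomputable def probGen {Ω : Type*} [MeasurableSpace Ω] (P : Measure Ω) (X : Ω → ℕ) (s : ℝ) : ℝ :=
  ∫ ω, s ^ X ω ∂P

/-! ### Backward composition of maps -/

/-- The composition `h j ∘ h (j + 1) ∘ ⋯ ∘ h (n - 1)` (the identity if `n ≤ j`). -/
def backIter (h : ℕ → ℝ → ℝ) : ℕ → ℕ → ℝ → ℝ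
  | 0, _, y => y
  | n + 1, j, y => if j ≤ n then backIter h n j (h n y) else y

theorem backIter_of_le (h : ℕ → ℝ → ℝ) {n j : ℕ} (hnj : n ≤ j) (y : ℝ) :
    backIter h n j y = y := by
  cases n with
  | zero => rfl
  | succ n => rw [backIter, if_neg (by omega)]

theorem backIter_succ (h : ℕ → ℝ → ℝ) {n j : ℕ} (hjn : j ≤ n) (y : ℝ) :
    backIter h (n + 1) j y = backIter h n j (h n y) := by
  rw [backIter, if_pos hjn]

theorem backIter_eq_apply (h : ℕ → ℝ → ℝ) {n j : ℕ} (hjn : j < n) (y : ℝ) :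
    backIter h n j y = h j (backIter h n (j + 1) y) := by
  induction n generalizing y with
  | zero => omega
  | succ n ih =>
    rcases Nat.lt_succ_iff_lt_or_eq.mp hjn with hlt | rfl
    · rw [backIter_succ h hlt.le, backIter_succ h (by omega), ih hlt]
    · rw [backIter_succ h le_rfl, backIter_of_le h le_rfl, backIter_of_le h le_rfl]

/-! ### Random sums and the generating function of the process -/

/-- The σ-algebra is an explicit argument because the lemma is also applied to the one generated by
the variables of earlier generations. -/
theorem measurable_randomSum {Ω : Type*} {m : MeasurableSpace Ω} {N : Ω → ℕ} {Z : ℕ → Ω → ℕ}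
    (hN : Measurable[m] N) (hZ : ∀ j, Measurable[m] (Z j)) :
    Measurable[m] (fun ω => ∑ j ∈ Finset.range (N ω), Z j ω) := by
  have : Measurable[Prod.instMeasurableSpace] (fun p : ℕ × Ω => ∑ j ∈ Finset.range p.1, Z j p.2) :=
    measurable_from_prod_countable_right
      fun k => (Finset.measurable_sum (Finset.range k) fun j _ => hZ j :)
  exact this.comp (hN.prodMk measurable_id)

/-- A sum over one finite set of the joint index type, to which joint independence of all variables
applies directly. -/
theorem sum_offspring_add_immigration_eq {Ω : Type*} (ξ : ℕ → ℕ → Ω → ℕ) (ε : ℕ → Ω → ℕ)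
    (n k : ℕ) (ω : Ω) :
    ∑ j ∈ Finset.range k, ξ n j ω + ε n ω =
      ∑ i ∈ Finset.disjSum ((Finset.range k).map (Function.Embedding.sectR n ℕ))
        {n}, Sum.elim (fun p : ℕ × ℕ => ξ p.1 p.2) ε i ω := by
  simp [Finset.sum_disjSum]

/-- The generation in which an offspring or immigration variable is used. -/
def generationOf : (ℕ × ℕ) ⊕ ℕ → ℕ := Sum.elim Prod.fst id

/-- The past is written as a supremum over indices so that its independence from generation `n`
reduces to disjointness of two index sets. -/
theorem measurable_branchingImmigration_iSup {Ω : Type*} (ξ : ℕ → ℕ → Ω → ℕ) (ε : ℕ → Ω → ℕ) (n : ℕ) :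
    Measurable[⨆ i ∈ {i | generationOf i < n},
      MeasurableSpace.comap (Sum.elim (fun p : ℕ × ℕ => ξ p.1 p.2) ε i) inferInstance]
      (branchingImmigration ξ ε n) := by
  have key : ∀ (n : ℕ) (i : (ℕ × ℕ) ⊕ ℕ), generationOf i < n →
      Measurable[⨆ i ∈ {i | generationOf i < n},
        MeasurableSpace.comap (Sum.elim (fun p : ℕ × ℕ => ξ p.1 p.2) ε i) inferInstance]
        (Sum.elim (fun p : ℕ × ℕ => ξ p.1 p.2) ε i) := fun n i hi =>
    Measurable.mono (comap_measurable _)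
      (le_iSup₂_of_le (f := fun i (_ : i ∈ {i | generationOf i < n}) =>
        MeasurableSpace.comap (Sum.elim (fun p : ℕ × ℕ => ξ p.1 p.2) ε i) inferInstance)
        i hi le_rfl) le_rfl
  induction n with
  | zero => exact measurable_const
  | succ n ih =>
    have hmono : Measurable[⨆ i ∈ {i | generationOf i < n + 1},
        MeasurableSpace.comap (Sum.elim (fun p : ℕ × ℕ => ξ p.1 p.2) ε i) inferInstance]
        (branchingImmigration ξ ε n) :=
      ih.mono (biSup_mono fun i (hi : generationOf i < n) => Nat.lt_succ_of_lt hi) le_rfl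
    refine Measurable.add (measurable_randomSum hmono fun j => ?_) ?_
    · exact key (n + 1) (Sum.inl (n, j)) (Nat.lt_succ_self n)
    · exact key (n + 1) (Sum.inr n) (Nat.lt_succ_self n)

section Prob

variable {Ω : Type*} [MeasurableSpace Ω] {P : Measure Ω}

theorem integrable_pow_of_mem_Icc [IsFiniteMeasure P] {X : Ω → ℕ} (hX : Measurable X) {s : ℝ}
    (hs : s ∈ Set.Icc (0 : ℝ) 1) : Integrable (fun ω => s ^ X ω) P := by
  refine Integrable.of_bound (C := 1) ?_ (ae_of_all _ fun ω => ?_)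
  · exact ((measurable_of_countable (fun n : ℕ => s ^ n)).comp hX).aestronglyMeasurable
  · rw [Real.norm_of_nonneg (pow_nonneg hs.1 _)]
    exact pow_le_one₀ hs.1 hs.2

theorem probGen_mem_Icc [IsProbabilityMeasure P] {X : Ω → ℕ} (hX : Measurable X) {s : ℝ}
    (hs : s ∈ Set.Icc (0 : ℝ) 1) : probGen P X s ∈ Set.Icc (0 : ℝ) 1 := by
  refine ⟨integral_nonneg fun ω => pow_nonneg hs.1 _, ?_⟩
  calc probGen P X s ≤ ∫ _, (1 : ℝ) ∂P :=
        integral_mono (integrable_pow_of_mem_Icc hX hs) (integrable_const _)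
          fun ω => pow_le_one₀ hs.1 hs.2
    _ = 1 := by simp

theorem probGen_one [IsProbabilityMeasure P] (X : Ω → ℕ) : probGen P X 1 = 1 := by
  simp [probGen]

theorem hasSum_setIntegral_fiber {N : Ω → ℕ} (hN : Measurable N) {F : Ω → ℝ}
    (hF : Integrable F P) : HasSum (fun k => ∫ ω in N ⁻¹' {k}, F ω ∂P) (∫ ω, F ω ∂P) := by
  have h := hasSum_integral_iUnion (μ := P) (f := F) (s := fun k => N ⁻¹' {k})
    (fun k => hN (measurableSet_singleton k))
    (fun i j hij => by
      rw [Function.onFun, Set.disjoint_left]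
      intro ω hi hj
      exact hij (hi.symm.trans hj)) hF.integrableOn
  rwa [← Set.preimage_iUnion, Set.iUnion_of_singleton, Set.preimage_univ, setIntegral_univ] at h

theorem hasSum_probGen [IsFiniteMeasure P] {X : Ω → ℕ} (hX : Measurable X) {s : ℝ}
    (hs : s ∈ Set.Icc (0 : ℝ) 1) :
    HasSum (fun k => P.real (X ⁻¹' {k}) * s ^ k) (probGen P X s) := by
  have h := hasSum_setIntegral_fiber hX (integrable_pow_of_mem_Icc (P := P) hX hs)
  refine h.congr_fun fun k => ?_
  rw [setIntegral_congr_fun (g := fun _ => s ^ k) (hX (measurableSet_singleton k))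
    (fun ω (hω : X ω = k) => by simp only [hω])]
  simp

theorem hasSum_measureReal_fiber [IsProbabilityMeasure P] {X : Ω → ℕ} (hX : Measurable X) :
    HasSum (fun k => P.real (X ⁻¹' {k})) 1 := by
  have h := hasSum_probGen (P := P) hX (s := 1) ⟨zero_le_one, le_rfl⟩
  rw [probGen_one] at h
  simpa using h

/-- The generating function of a random sum with an independent number of summands. -/
theorem probGen_randomSum [IsProbabilityMeasure P] {N : Ω → ℕ} {Z : ℕ → Ω → ℕ} {E : Ω → ℕ}
    (hN : Measurable N) (hZ : ∀ j, Measurable (Z j)) (hE : Measurable E)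
    {s h g : ℝ} (hs : s ∈ Set.Icc (0 : ℝ) 1) (hh : h ∈ Set.Icc (0 : ℝ) 1)
    (hind : ∀ k, IndepFun N (fun ω => ∑ j ∈ Finset.range k, Z j ω + E ω) P)
    (hval : ∀ k, probGen P (fun ω => ∑ j ∈ Finset.range k, Z j ω + E ω) s = h ^ k * g) :
    probGen P (fun ω => ∑ j ∈ Finset.range (N ω), Z j ω + E ω) s = probGen P N h * g := by
  have hm : Measurable (fun ω => ∑ j ∈ Finset.range (N ω), Z j ω + E ω) :=
    (measurable_randomSum hN hZ).add hE
  -- Split over the events `N = k`; on each of them independence factors the integral, and the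
  -- resulting series is that of `probGen P N` at `h`.
  have h1 := hasSum_setIntegral_fiber hN (integrable_pow_of_mem_Icc (P := P) hm hs)
  have h2 := (hasSum_probGen (P := P) hN hh).mul_right g
  refine h1.unique (h2.congr_fun fun k => ?_)
  have hmk : Measurable (fun ω => ∑ j ∈ Finset.range k, Z j ω + E ω) :=
    (Finset.measurable_sum _ fun j _ => hZ j).add hE
  rw [setIntegral_congr_fun (g := fun ω => s ^ (∑ j ∈ Finset.range k, Z j ω + E ω))
    (hN (measurableSet_singleton k)) (fun ω (hω : N ω = k) => by simp only [hω])]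
  rw [Indep.setIntegral_eq_mul (m := MeasurableSpace.comap N inferInstance) hN.comap_le
    (f := fun n : ℕ => s ^ n) (X := fun ω => ∑ j ∈ Finset.range k, Z j ω + E ω) (hind k)
    hmk.aemeasurable ⟨{k}, measurableSet_singleton k, rfl⟩
    (measurable_of_countable _).aestronglyMeasurable, mul_assoc, ← hval k, probGen]

theorem probGen_sum [IsProbabilityMeasure P] {ι : Type*} {X : ι → Ω → ℕ}
    (hX : ∀ i, Measurable (X i)) (hind : iIndepFun X P) (A : Finset ι) (s : ℝ) :
    probGen P (fun ω => ∑ i ∈ A, X i ω) s = ∏ i ∈ A, probGen P (X i) s := by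
  have h := (hind.precomp (g := ((↑) : A → ι)) Subtype.val_injective).integral_fun_prod_comp
    (f := fun _ n => s ^ n) (fun i => (hX i).aemeasurable)
    (fun i => (measurable_of_countable _).aestronglyMeasurable)
  simp only [probGen, ← Finset.prod_pow_eq_pow_sum]
  rw [← Finset.prod_coe_sort A fun i => ∫ ω, s ^ X i ω ∂P, ← h]
  congr with ω
  exact (Finset.prod_coe_sort A fun i => s ^ X i ω).symm

theorem probGen_congr_identDistrib {X Y : Ω → ℕ} (h : IdentDistrib X Y P P) (s : ℝ) :
    probGen P X s = probGen P Y s :=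
  (h.comp (measurable_of_countable fun n : ℕ => s ^ n)).integral_eq

theorem measurable_branchingImmigration {ξ : ℕ → ℕ → Ω → ℕ} {ε : ℕ → Ω → ℕ}
    (hξ : ∀ n j, Measurable (ξ n j)) (hε : ∀ n, Measurable (ε n)) (n : ℕ) :
    Measurable (branchingImmigration ξ ε n) := by
  induction n with
  | zero => exact measurable_const
  | succ n ih => exact (measurable_randomSum ih (hξ n)).add (hε n)

theorem indepFun_branchingImmigration {ξ : ℕ → ℕ → Ω → ℕ} {ε : ℕ → Ω → ℕ}
    (hξ : ∀ n j, Measurable (ξ n j)) (hε : ∀ n, Measurable (ε n))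
    (hindep : iIndepFun (Sum.elim (fun p : ℕ × ℕ => ξ p.1 p.2) ε) P) (n k : ℕ) :
    IndepFun (branchingImmigration ξ ε n) (fun ω => ∑ j ∈ Finset.range k, ξ n j ω + ε n ω) P := by
  have hle : ∀ i, MeasurableSpace.comap (Sum.elim (fun p : ℕ × ℕ => ξ p.1 p.2) ε i) inferInstance
      ≤ (inferInstance : MeasurableSpace Ω) := by
    rintro (p | m)
    · exact (hξ p.1 p.2).comap_le
    · exact (hε m).comap_le
  have h := indep_iSup_of_disjoint hle hindep (S := {i | generationOf i < n})
    (T := {i | generationOf i = n})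
    (Set.disjoint_left.mpr fun i (hi : _ < n) (hi' : _ = n) => by omega)
  refine indep_of_indep_of_le_left (indep_of_indep_of_le_right h ?_)
    (measurable_branchingImmigration_iSup ξ ε n).comap_le
  refine Measurable.comap_le (Measurable.add (Finset.measurable_sum _ fun j _ => ?_) ?_)
  · exact Measurable.mono (comap_measurable _)
      (le_iSup₂_of_le (f := fun i (_ : i ∈ {i | generationOf i = n}) =>
        MeasurableSpace.comap (Sum.elim (fun p : ℕ × ℕ => ξ p.1 p.2) ε i) inferInstance)
        (Sum.inl (n, j)) rfl le_rfl) le_rfl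
  · exact Measurable.mono (comap_measurable _)
      (le_iSup₂_of_le (f := fun i (_ : i ∈ {i | generationOf i = n}) =>
        MeasurableSpace.comap (Sum.elim (fun p : ℕ × ℕ => ξ p.1 p.2) ε i) inferInstance)
        (Sum.inr n) rfl le_rfl) le_rfl

/-- `1 - E[(1 - x) ^ X]`. -/
noncomputable def coGen (P : Measure Ω) (X : Ω → ℕ) (x : ℝ) : ℝ := 1 - probGen P X (1 - x)

/-- The generating function of the branching process with immigration. -/
theorem probGen_branchingImmigration [IsProbabilityMeasure P] {ξ : ℕ → ℕ → Ω → ℕ} {ε : ℕ → Ω → ℕ}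
    (hξ : ∀ n j, Measurable (ξ n j)) (hε : ∀ n, Measurable (ε n))
    (hindep : iIndepFun (Sum.elim (fun p : ℕ × ℕ => ξ p.1 p.2) ε) P)
    (hident : ∀ n j, IdentDistrib (ξ n j) (ξ n 0) P P) (n : ℕ) {y : ℝ}
    (hy : y ∈ Set.Icc (0 : ℝ) 1) :
    probGen P (branchingImmigration ξ ε n) (1 - y) =
      ∏ j ∈ Finset.range n,
        (1 - coGen P (ε j) (backIter (fun m => coGen P (ξ m 0)) n (j + 1) y)) := by
  induction n generalizing y with
  | zero => simp [probGen, branchingImmigration]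
  | succ n ih =>
    have hs : 1 - y ∈ Set.Icc (0 : ℝ) 1 := ⟨by linarith [hy.2], by linarith [hy.1]⟩
    have hh := probGen_mem_Icc (P := P) (hξ n 0) hs
    have hy' : coGen P (ξ n 0) y ∈ Set.Icc (0 : ℝ) 1 :=
      ⟨by rw [coGen]; linarith [hh.2], by rw [coGen]; linarith [hh.1]⟩
    have hmeas : ∀ i, Measurable (Sum.elim (fun p : ℕ × ℕ => ξ p.1 p.2) ε i) := by
      rintro (p | m)
      · exact hξ p.1 p.2
      · exact hε m
    have h := probGen_randomSum (P := P) (measurable_branchingImmigration hξ hε n) (hξ n) (hε n)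
      (g := probGen P (ε n) (1 - y)) hs hh (indepFun_branchingImmigration hξ hε hindep n)
      (fun k => by
        simp only [sum_offspring_add_immigration_eq]
        rw [probGen_sum hmeas hindep, Finset.prod_disjSum]
        simp only [Finset.prod_map, Sum.elim_inl, Sum.elim_inr, Finset.prod_singleton,
          Function.Embedding.sectR_apply, probGen_congr_identDistrib (hident n _),
          Finset.prod_const, Finset.card_range])
    -- The newest immigrants have no descendants yet, so their factor is evaluated at `y` itself;
    -- all older factors see `h n y` in place of `y`.
    rw [Finset.prod_range_succ, backIter_of_le _ le_rfl]
    change probGen P (fun ω => ∑ j ∈ Finset.range (branchingImmigration ξ ε n ω), ξ n j ω + ε n ω)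
      (1 - y) = _
    rw [h]
    have e1 : probGen P (ξ n 0) (1 - y) = 1 - coGen P (ξ n 0) y := by rw [coGen]; ring
    have e2 : probGen P (ε n) (1 - y) = 1 - coGen P (ε n) y := by rw [coGen]; ring
    rw [e1, e2, ih hy']
    congr 1
    refine Finset.prod_congr rfl fun j hj => ?_
    rw [backIter_succ _ (Finset.mem_range.mp hj)]

end Prob

/-! ### Bonferroni brackets for generating functions -/

/-- Bonferroni inequalities for the binomial expansion of `(1 - x) ^ n`. -/
theorem bonferroni_one_sub_pow (n K : ℕ) {x : ℝ} (hx : x ∈ Set.Icc (0 : ℝ) 1) :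
    0 ≤ (-1) ^ (K + 1) *
      ((1 - x) ^ n - ∑ k ∈ Finset.range (K + 1), (-1) ^ k * (n.choose k : ℝ) * x ^ k) := by
  have hx' : 0 ≤ 1 - x := by linarith [hx.2]
  induction n generalizing K with
  | zero => simp [Finset.sum_range_succ']
  | succ n ih =>
    cases K with
    | zero =>
      have := pow_le_one₀ (n := n + 1) hx' (by linarith [hx.1])
      simp
      linarith
    | succ K =>
      -- By Pascal's rule the remainders satisfy `R (n+1) (K+1) = R n (K+1) - x * R n K`, and after
      -- multiplication by the sign both terms are nonnegative.
      have e : ∑ k ∈ Finset.range (K + 1 + 1), (-1) ^ k * ((n + 1).choose k : ℝ) * x ^ k =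
          ∑ k ∈ Finset.range (K + 1 + 1), (-1) ^ k * (n.choose k : ℝ) * x ^ k -
            x * ∑ k ∈ Finset.range (K + 1), (-1) ^ k * (n.choose k : ℝ) * x ^ k := by
        rw [Finset.sum_range_succ', Finset.sum_range_succ' _ (K + 1), Finset.mul_sum,
          add_sub_right_comm, ← Finset.sum_sub_distrib]
        congr 1
        · refine Finset.sum_congr rfl fun k _ => ?_
          rw [Nat.choose_succ_succ]
          push_cast
          ring
        · simp
      have h1 := ih (K + 1)
      have h2 := mul_nonneg hx.1 (ih K)
      rw [e]
      calc (0 : ℝ) ≤ _ := add_nonneg h1 h2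
        _ = _ := by ring

section Prob

variable {Ω : Type*} [MeasurableSpace Ω] {P : Measure Ω}

theorem integrable_descFactorial {X : Ω → ℕ} (hX : Measurable X) {k : ℕ}
    (hk : factorialMoment P X k ≠ ∞) : Integrable (fun ω => ((X ω).descFactorial k : ℝ)) P := by
  have h := integrable_toReal_of_lintegral_ne_top (μ := P)
    (f := fun ω => ((X ω).descFactorial k : ℝ≥0∞))
    ((measurable_of_countable fun n : ℕ => (n.descFactorial k : ℝ≥0∞)).comp hX).aemeasurable hk
  simpa using h

theorem integral_descFactorial {X : Ω → ℕ} (hX : Measurable X) (k : ℕ) :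
    ∫ ω, ((X ω).descFactorial k : ℝ) ∂P = (factorialMoment P X k).toReal := by
  have h := integral_toReal (μ := P) (f := fun ω => ((X ω).descFactorial k : ℝ≥0∞))
    ((measurable_of_countable fun n : ℕ => (n.descFactorial k : ℝ≥0∞)).comp hX).aemeasurable
    (ae_of_all _ fun ω => ENNReal.natCast_lt_top _)
  simpa [factorialMoment] using h

theorem natCast_choose_eq_descFactorial_div (n k : ℕ) :
    (n.choose k : ℝ) = (n.descFactorial k : ℝ) / (k.factorial : ℝ) := by
  rw [Nat.descFactorial_eq_factorial_mul_choose]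
  push_cast
  rw [mul_div_cancel_left₀]
  exact_mod_cast k.factorial_ne_zero

theorem coGen_mem_Icc [IsProbabilityMeasure P] {X : Ω → ℕ} (hX : Measurable X) {x : ℝ}
    (hx : x ∈ Set.Icc (0 : ℝ) 1) : coGen P X x ∈ Set.Icc (0 : ℝ) 1 := by
  have h := probGen_mem_Icc (P := P) hX (s := 1 - x) ⟨by linarith [hx.2], by linarith [hx.1]⟩
  exact ⟨by rw [coGen]; linarith [h.2], by rw [coGen]; linarith [h.1]⟩

/-- Bonferroni inequalities for the expansion of a generating function at `1` in terms of
factorial moments. -/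
theorem bonferroni_coGen [IsProbabilityMeasure P] {X : Ω → ℕ} (hX : Measurable X) (K : ℕ)
    (hfin : ∀ k < K, factorialMoment P X (k + 1) ≠ ∞) {x : ℝ} (hx : x ∈ Set.Icc (0 : ℝ) 1) :
    0 ≤ (-1) ^ (K + 1) * (∑ k ∈ Finset.range K,
      (-1) ^ k * ((factorialMoment P X (k + 1)).toReal / ((k + 1).factorial : ℝ)) * x ^ (k + 1) -
        coGen P X x) := by
  have hs : 1 - x ∈ Set.Icc (0 : ℝ) 1 := ⟨by linarith [hx.2], by linarith [hx.1]⟩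
  have hint : ∀ k ∈ Finset.range K, Integrable (fun ω =>
      (-1) ^ k * (((X ω).descFactorial (k + 1) : ℝ) / ((k + 1).factorial : ℝ)) * x ^ (k + 1)) P :=
    fun k hk => (((integrable_descFactorial hX (hfin k (Finset.mem_range.mp hk))).div_const
      _).const_mul _).mul_const _
  have hpt : ∀ ω, 0 ≤ (-1) ^ (K + 1) * (∑ k ∈ Finset.range K,
      (-1) ^ k * (((X ω).descFactorial (k + 1) : ℝ) / ((k + 1).factorial : ℝ)) * x ^ (k + 1) -
        (1 - (1 - x) ^ X ω)) := by
    intro ω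
    refine (bonferroni_one_sub_pow (X ω) K hx).trans_eq ?_
    -- The term `k = 0` is the `1` in `1 - (1 - x) ^ X`; removing it shifts the index and flips the
    -- signs.
    rw [Finset.sum_range_succ']
    congr 1
    simp only [← natCast_choose_eq_descFactorial_div, pow_succ (-1 : ℝ), mul_neg, mul_one, neg_mul,
      Finset.sum_neg_distrib]
    simp only [pow_zero, Nat.choose_zero_right, Nat.cast_one, one_mul]
    ring
  have hI := integral_nonneg_of_ae (μ := P) (ae_of_all _ hpt)
  rw [integral_const_mul, integral_sub (integrable_finsetSum _ hint)
    (g := fun ω => 1 - (1 - x) ^ X ω)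
    ((integrable_const 1).sub (integrable_pow_of_mem_Icc hX hs)), integral_finsetSum _ hint,
    integral_sub (integrable_const 1) (integrable_pow_of_mem_Icc hX hs)] at hI
  simp only [integral_mul_const, integral_const_mul, integral_div, integral_descFactorial hX] at hI
  simpa [coGen, probGen] using hI

/-- Dominated convergence, with no moment assumption. This disposes of the finitely many early
generations whose factorial moments may be infinite. -/
theorem tendsto_coGen_zero [IsProbabilityMeasure P] {X : Ω → ℕ} (hX : Measurable X) {x : ℕ → ℝ}
    (hx : ∀ n, x n ∈ Set.Icc (0 : ℝ) 1) (hx0 : Tendsto x atTop (𝓝 0)) :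
    Tendsto (fun n => coGen P X (x n)) atTop (𝓝 0) := by
  have hs : ∀ n, 1 - x n ∈ Set.Icc (0 : ℝ) 1 := fun n =>
    ⟨by linarith [(hx n).2], by linarith [(hx n).1]⟩
  have h : Tendsto (fun n => ∫ ω, (1 - x n) ^ X ω ∂P) atTop (𝓝 (∫ ω, (1 - 0 : ℝ) ^ X ω ∂P)) := by
    refine tendsto_integral_of_dominated_convergence (fun _ => 1)
      (fun n => (integrable_pow_of_mem_Icc hX (hs n)).aestronglyMeasurable) (integrable_const 1)
      (fun n => ae_of_all _ fun ω => ?_) (ae_of_all _ fun ω => (hx0.const_sub 1).pow _)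
    rw [Real.norm_of_nonneg (pow_nonneg (hs n).1 _)]
    exact pow_le_one₀ (hs n).1 (hs n).2
  have h' := h.const_sub 1
  simpa [coGen, probGen] using h'

/-- The generating function of the descendants at time `n` of the immigrants of generation
`j + 1`. -/
theorem probGen_branchingImmigration_single [IsProbabilityMeasure P] {ξ : ℕ → ℕ → Ω → ℕ}
    {ε : ℕ → Ω → ℕ} (hξ : ∀ n j, Measurable (ξ n j)) (hε : ∀ n, Measurable (ε n))
    (hindep : iIndepFun (Sum.elim (fun p : ℕ × ℕ => ξ p.1 p.2) ε) P)
    (hident : ∀ n j, IdentDistrib (ξ n j) (ξ n 0) P P) {n j : ℕ} (hj : j < n) {y : ℝ}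
    (hy : y ∈ Set.Icc (0 : ℝ) 1) :
    probGen P (branchingImmigration ξ (fun m ω => if m = j then ε m ω else 0) n) (1 - y) =
      1 - coGen P (ε j) (backIter (fun m => coGen P (ξ m 0)) n (j + 1) y) := by
  have hε' : ∀ m, Measurable fun ω => if m = j then ε m ω else 0 := fun m => by
    split_ifs
    exacts [hε m, measurable_const]
  have hind' : iIndepFun (Sum.elim (fun p : ℕ × ℕ => ξ p.1 p.2)
      (fun m ω => if m = j then ε m ω else 0)) P := by
    -- Suppressing all other immigration is a map applied to each variable separately, so
    -- independence survives.
    have h := hindep.comp (Sum.elim (fun _ => id) (fun m k => if m = j then k else 0))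
      (fun i => measurable_of_countable _)
    convert h using 1
    funext i
    rcases i with p | m <;> rfl
  rw [probGen_branchingImmigration hξ hε' hind' hident n hy,
    Finset.prod_eq_single_of_mem j (Finset.mem_range.mpr hj)]
  · simp
  · intro m _ hm
    simp [hm, coGen, probGen]

end Prob

/-! ### A Toeplitz lemma and the limiting integral -/

/-- A Toeplitz lemma for triangular arrays. -/
theorem tendsto_sum_range_of_dominated {t a : ℕ → ℕ → ℝ} {c : ℕ → ℝ} {C : ℝ}
    (ha : ∀ n j, j < n → 0 ≤ a n j) (hsum : ∀ n, ∑ j ∈ Finset.range n, a n j ≤ C)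
    (hc : Tendsto c atTop (𝓝 0)) (ht : ∀ j, Tendsto (fun n => t n j) atTop (𝓝 0))
    (hb : ∀ᶠ j in atTop, ∀ n, j < n → |t n j| ≤ c j * a n j) :
    Tendsto (fun n => ∑ j ∈ Finset.range n, t n j) atTop (𝓝 0) := by
  have hC : 0 ≤ C := by simpa using hsum 0
  rw [Metric.tendsto_atTop]
  intro ε hε
  -- With this bound on `c j` the terms `j ≥ J` contribute at most `ε / 2`; the `+ 1` covers `C =
  -- 0`. The finitely many terms `j < J` vanish one by one.
  have hη : 0 < ε / (2 * (C + 1)) := by positivity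
  obtain ⟨J, hJ⟩ := eventually_atTop.mp (hb.and (hc.eventually (gt_mem_nhds hη)))
  have hfin : Tendsto (fun n => ∑ j ∈ Finset.range J, |t n j|) atTop (𝓝 0) := by
    have := tendsto_finsetSum (Finset.range J) fun j _ => (ht j).abs
    simpa using this
  obtain ⟨M, hM⟩ := eventually_atTop.mp (hfin.eventually (gt_mem_nhds (half_pos hε)))
  refine ⟨max J M, fun n hn => ?_⟩
  have hJn : J ≤ n := (le_max_left _ _).trans hn
  have h1 := hM n ((le_max_right _ _).trans hn)
  have h2 : ∑ j ∈ Finset.Ico J n, |t n j| ≤ ε / (2 * (C + 1)) * C := by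
    calc ∑ j ∈ Finset.Ico J n, |t n j|
        ≤ ∑ j ∈ Finset.Ico J n, ε / (2 * (C + 1)) * a n j := by
          refine Finset.sum_le_sum fun j hj => ?_
          rw [Finset.mem_Ico] at hj
          exact ((hJ j hj.1).1 n hj.2).trans
            (mul_le_mul_of_nonneg_right (hJ j hj.1).2.le (ha n j hj.2))
      _ = ε / (2 * (C + 1)) * ∑ j ∈ Finset.Ico J n, a n j := by rw [Finset.mul_sum]
      _ ≤ ε / (2 * (C + 1)) * C := by
          refine mul_le_mul_of_nonneg_left (le_trans ?_ (hsum n)) hη.le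
          refine Finset.sum_le_sum_of_subset_of_nonneg (fun j hj => ?_) fun j hj _ =>
            ha n j (Finset.mem_range.mp hj)
          exact Finset.mem_range.mpr (Finset.mem_Ico.mp hj).2
  have h3 : ε / (2 * (C + 1)) * C ≤ ε / 2 := by
    rw [div_mul_eq_mul_div, div_le_div_iff₀ (by positivity) two_pos]
    nlinarith
  rw [Real.dist_eq, sub_zero]
  calc |∑ j ∈ Finset.range n, t n j| ≤ ∑ j ∈ Finset.range n, |t n j| :=
        Finset.abs_sum_le_sum_abs _ _
    _ = ∑ j ∈ Finset.range J, |t n j| + ∑ j ∈ Finset.Ico J n, |t n j| :=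
        (Finset.sum_range_add_sum_Ico _ hJn).symm
    _ < ε := by linarith

/-- The function `y ↦ ∫ t in 0..y, t ^ k / (1 + ν t / 2)`, in closed form. -/
noncomputable def limitPrimitive (ν : ℝ) (k : ℕ) (y : ℝ) : ℝ :=
  (-1) ^ k * limitTerm ν (k + 1) (1 - y)

theorem limitPrimitive_zero (ν : ℝ) (k : ℕ) : limitPrimitive ν k 0 = 0 := by
  rw [limitPrimitive, limitTerm]
  split_ifs
  · simp
  · rw [Finset.sum_eq_zero]
    · simp
    · intro i hi
      rw [Finset.mem_Ico] at hi
      simp [show i ≠ 0 by omega]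

/-- For `ν > 0` the finite sum in `limitTerm` removes the Taylor polynomial of degree `k` of the
logarithm. Differentiating therefore leaves the remainder of a geometric series, and the prefactor
normalises it. -/
theorem hasDerivAt_limitPrimitive {ν : ℝ} (hν : 0 ≤ ν) (k : ℕ) {y : ℝ} (hy : 0 ≤ y) :
    HasDerivAt (limitPrimitive ν k) (y ^ k / (1 + ν / 2 * y)) y := by
  have hsq : ∀ k : ℕ, ((-1 : ℝ) ^ k) * (-1) ^ k = 1 := fun k => by
    rw [← mul_pow]; simp
  rcases hν.eq_or_lt with rfl | hν
  · have e : limitPrimitive 0 k = fun y => y ^ (k + 1) / ((k : ℝ) + 1) := by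
      funext y
      simp only [limitPrimitive, limitTerm, if_true, sub_sub_cancel]
      push_cast
      rw [pow_succ (-1 : ℝ) (k + 1), pow_succ (-1 : ℝ) k]
      have := hsq k
      linear_combination (y ^ (k + 1) / ((k : ℝ) + 1)) * this
    rw [e]
    have h := (hasDerivAt_pow (k + 1) y).div_const ((k : ℝ) + 1)
    refine h.congr_deriv ?_
    have : (k : ℝ) + 1 ≠ 0 := by positivity
    push_cast
    field_simp
    simp
  · have hpos : 0 < 1 + ν / 2 * y := by positivity
    have e : limitPrimitive ν k = fun y => (-1) ^ k * (2 ^ (k + 1) / ν ^ (k + 1) *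
        (Real.log (1 + ν / 2 * y) +
          ∑ i ∈ Finset.range k, -((-ν / 2) ^ i * (ν / 2)) / ((i : ℝ) + 1) * y ^ (i + 1))) := by
      funext y
      simp only [limitPrimitive, limitTerm, if_neg hν.ne', sub_sub_cancel]
      rw [Finset.sum_Ico_eq_sum_range]
      congr 3
      refine Finset.sum_congr rfl fun i _ => ?_
      have : (i : ℝ) + 1 ≠ 0 := by positivity
      rw [add_comm 1 i]
      push_cast
      rw [show -ν / 2 = -(ν / 2) by ring, neg_pow (ν / 2), div_pow]
      field_simp
      ring
    rw [e]
    have h1 : HasDerivAt (fun y => Real.log (1 + ν / 2 * y)) (ν / 2 / (1 + ν / 2 * y)) y := by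
      have := (((hasDerivAt_id y).const_mul (ν / 2)).const_add 1).log hpos.ne'
      simpa using this
    have h2 : HasDerivAt (fun y => ∑ i ∈ Finset.range k,
        -((-ν / 2) ^ i * (ν / 2)) / ((i : ℝ) + 1) * y ^ (i + 1))
        (∑ i ∈ Finset.range k, -((-ν / 2) ^ i * (ν / 2)) / ((i : ℝ) + 1) *
          ((i + 1 : ℕ) * y ^ i)) y := by
      refine HasDerivAt.fun_sum fun i _ => ?_
      simpa using (hasDerivAt_pow (i + 1) y).const_mul (-((-ν / 2) ^ i * (ν / 2)) / ((i : ℝ) + 1))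
    refine (((h1.add h2).const_mul (2 ^ (k + 1) / ν ^ (k + 1))).const_mul
      ((-1) ^ k)).congr_deriv ?_
    symm
    have e2 : ∑ i ∈ Finset.range k, -((-ν / 2) ^ i * (ν / 2)) / ((i : ℝ) + 1) *
          ((i + 1 : ℕ) * y ^ i) = -(ν / 2) * ∑ i ∈ Finset.range k, (-ν / 2 * y) ^ i := by
      rw [Finset.mul_sum]
      refine Finset.sum_congr rfl fun i _ => ?_
      have : (i : ℝ) + 1 ≠ 0 := by positivity
      rw [mul_pow]
      push_cast
      field_simp
    have hgeom := geom_sum_mul_neg (-ν / 2 * y) k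
    have e3 : ∑ i ∈ Finset.range k, (-ν / 2 * y) ^ i =
        (1 - (-ν / 2 * y) ^ k) / (1 + ν / 2 * y) := by
      rw [eq_div_iff hpos.ne', ← hgeom]
      ring
    rw [e2, e3]
    have e4 : ν / 2 / (1 + ν / 2 * y) + -(ν / 2) * ((1 - (-ν / 2 * y) ^ k) / (1 + ν / 2 * y)) =
        (ν / 2) * ((-ν / 2 * y) ^ k / (1 + ν / 2 * y)) := by ring
    have e5 : (-ν / 2 * y) ^ k = (-1) ^ k * (ν ^ k / 2 ^ k * y ^ k) := by
      rw [show -ν / 2 * y = (-1) * (ν / 2 * y) by ring, mul_pow, mul_pow, div_pow]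
    have e6 : (2 : ℝ) ^ (k + 1) / ν ^ (k + 1) * (ν / 2 * (ν ^ k / 2 ^ k)) = 1 := by
      have := hν.ne'
      field_simp
      ring
    rw [e4, e5]
    calc y ^ k / (1 + ν / 2 * y) = (((-1 : ℝ) ^ k) * (-1) ^ k) *
        (2 ^ (k + 1) / ν ^ (k + 1) * (ν / 2 * (ν ^ k / 2 ^ k))) * (y ^ k / (1 + ν / 2 * y)) := by
          rw [hsq, e6]; ring
      _ = _ := by ring

theorem exists_limitPrimitive_sub_eq {ν : ℝ} (hν : 0 ≤ ν) (k : ℕ) {x y : ℝ} (hx : 0 ≤ x)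
    (hxy : x ≤ y) : ∃ w ∈ Set.Icc x y,
      limitPrimitive ν k y - limitPrimitive ν k x = w ^ k / (1 + ν / 2 * w) * (y - x) := by
  rcases hxy.eq_or_lt with rfl | hlt
  · exact ⟨x, ⟨le_rfl, le_rfl⟩, by simp⟩
  · obtain ⟨w, hw, he⟩ := exists_hasDerivAt_eq_slope (limitPrimitive ν k)
      (fun w => w ^ k / (1 + ν / 2 * w)) hlt
      (fun w hw => (hasDerivAt_limitPrimitive hν k (hx.trans hw.1)).continuousAt.continuousWithinAt)
      (fun w hw => hasDerivAt_limitPrimitive hν k (hx.trans hw.1.le))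
    refine ⟨w, ⟨hw.1.le, hw.2.le⟩, ?_⟩
    rw [he, div_mul_cancel₀]
    linarith

/-- The derivative lies between `0` and `t ^ k`. The bound gives absolute convergence of the series
and, for `k = 0`, the linear bound on the exponent. -/
theorem limitPrimitive_mem_Icc {ν : ℝ} (hν : 0 ≤ ν) (k : ℕ) {y : ℝ} (hy : 0 ≤ y) :
    limitPrimitive ν k y ∈ Set.Icc 0 (y ^ (k + 1)) := by
  obtain ⟨w, hw, he⟩ := exists_limitPrimitive_sub_eq hν k le_rfl hy
  rw [limitPrimitive_zero, sub_zero, sub_zero] at he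
  have hw0 : 0 ≤ w := hw.1
  have h1 : 1 ≤ 1 + ν / 2 * w := by nlinarith
  have h2 : w ^ k / (1 + ν / 2 * w) ≤ y ^ k :=
    (div_le_self (pow_nonneg hw0 k) h1).trans (pow_le_pow_left₀ hw0 hw.2 k)
  rw [he, pow_succ]
  exact ⟨by positivity, mul_le_mul_of_nonneg_right h2 hy⟩

theorem exists_limitPrimitive_taylor {ν : ℝ} (hν : 0 ≤ ν) (k : ℕ) :
    ∃ B : ℝ, 0 ≤ B ∧ ∀ x y : ℝ, 0 ≤ x → x ≤ y → y ≤ 1 →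
      |limitPrimitive ν k y - limitPrimitive ν k x - y ^ k / (1 + ν / 2 * y) * (y - x)| ≤
        B * (y - x) ^ 2 := by
  -- A Lipschitz constant on `[0, 1]` for the derivative: `k` comes from the power, the rest from
  -- the cross terms of the difference of quotients.
  refine ⟨k + ν / 2 * (1 + k), by positivity, fun x y hx hxy hy => ?_⟩
  obtain ⟨w, hw, he⟩ := exists_limitPrimitive_sub_eq hν k hx hxy
  have hw0 : 0 ≤ w := hx.trans hw.1
  have hw1 : w ≤ 1 := hw.2.trans hy
  have hy0 : 0 ≤ y := hx.trans hxy
  have hpow : |w ^ k - y ^ k| ≤ k * (y - x) := by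
    have h := abs_pow_sub_pow_le w y k
    have h1 : max |w| |y| ^ (k - 1) ≤ 1 := pow_le_one₀ (by positivity)
      (max_le (by rw [abs_of_nonneg hw0]; exact hw1) (by rw [abs_of_nonneg hy0]; exact hy))
    have h2 : |w - y| ≤ y - x := by rw [abs_le]; constructor <;> linarith [hw.1, hw.2]
    calc |w ^ k - y ^ k| ≤ |w - y| * k * max |w| |y| ^ (k - 1) := h
      _ ≤ |w - y| * k * 1 := mul_le_mul_of_nonneg_left h1 (by positivity)
      _ ≤ k * (y - x) := by nlinarith [Nat.cast_nonneg (α := ℝ) k]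
  have hd : |w ^ k / (1 + ν / 2 * w) - y ^ k / (1 + ν / 2 * y)| ≤
      (k + ν / 2 * (1 + k)) * (y - x) := by
    have p1 : 1 ≤ 1 + ν / 2 * w := by nlinarith
    have p2 : 1 ≤ 1 + ν / 2 * y := by nlinarith
    rw [div_sub_div _ _ (by linarith) (by linarith), abs_div]
    refine (div_le_self (abs_nonneg _) ?_).trans ?_
    · rw [abs_of_nonneg (by positivity)]
      nlinarith
    · have e : w ^ k * (1 + ν / 2 * y) - (1 + ν / 2 * w) * y ^ k =
          (w ^ k - y ^ k) + ν / 2 * (y ^ k * (y - w) + y * (w ^ k - y ^ k)) := by ring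
      rw [e]
      have hyk : y ^ k ≤ 1 := pow_le_one₀ hy0 hy
      have hyk0 : 0 ≤ y ^ k := pow_nonneg hy0 k
      have i1 : |y ^ k * (y - w)| ≤ 1 * (y - x) := by
        rw [abs_mul, abs_of_nonneg hyk0, abs_of_nonneg (by linarith [hw.2])]
        exact mul_le_mul hyk (by linarith [hw.1]) (by linarith [hw.2]) zero_le_one
      have i2 : |y * (w ^ k - y ^ k)| ≤ k * (y - x) := by
        rw [abs_mul, abs_of_nonneg hy0]
        exact (mul_le_of_le_one_left (abs_nonneg _) hy).trans hpow
      calc _ ≤ |w ^ k - y ^ k| + |ν / 2 * (y ^ k * (y - w) + y * (w ^ k - y ^ k))| := abs_add_le _ _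
        _ ≤ k * (y - x) + ν / 2 * (1 * (y - x) + k * (y - x)) := by
          rw [abs_mul, abs_of_nonneg (by positivity : 0 ≤ ν / 2)]
          gcongr
          exact (abs_add_le _ _).trans (add_le_add i1 i2)
        _ = _ := by ring
  rw [he, ← sub_mul, abs_mul, abs_of_nonneg (by linarith : 0 ≤ y - x), sq, ← mul_assoc]
  exact mul_le_mul_of_nonneg_right hd (by linarith)

/-! ### Asymptotics along backward orbits of nearly critical maps -/

/-- A sequence of maps of `[0, 1]` with `h j u = u - δ j (u + ν u ^ 2 / 2) + o(δ j u)`, where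
`δ j → 0` and `∑ δ j = ∞`. -/
structure NearCritical (δ : ℕ → ℝ) (ν : ℝ) (h : ℕ → ℝ → ℝ) : Prop where
  nonneg : 0 ≤ ν
  pos : ∀ j, 0 < δ j
  tendsto : Tendsto δ atTop (𝓝 0)
  sum_tendsto : Tendsto (fun n => ∑ j ∈ Finset.range n, δ j) atTop atTop
  mapsTo : ∀ j, ∀ u ∈ Set.Icc (0 : ℝ) 1, h j u ∈ Set.Icc (0 : ℝ) 1
  le : ∀ j, ∀ u ∈ Set.Icc (0 : ℝ) 1, h j u ≤ (1 - δ j) * u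
  approx : ∃ ρ : ℕ → ℝ, Tendsto ρ atTop (𝓝 0) ∧ ∀ᶠ j in atTop, ∀ u ∈ Set.Icc (0 : ℝ) 1,
    |u - h j u - δ j * (u + ν / 2 * u ^ 2)| ≤ ρ j * (δ j * u)

namespace NearCritical

variable {δ : ℕ → ℝ} {ν : ℝ} {h : ℕ → ℝ → ℝ}

theorem backIter_mem (H : NearCritical δ ν h) (n j : ℕ) {y : ℝ} (hy : y ∈ Set.Icc (0 : ℝ) 1) :
    backIter h n j y ∈ Set.Icc (0 : ℝ) 1 := by
  induction n generalizing y with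
  | zero => exact hy
  | succ n ih =>
    rw [backIter]
    split_ifs
    · exact ih (H.mapsTo n y hy)
    · exact hy

theorem mul_backIter_le (H : NearCritical δ ν h) {n j : ℕ} (hj : j < n) {y : ℝ}
    (hy : y ∈ Set.Icc (0 : ℝ) 1) :
    δ j * backIter h n (j + 1) y ≤ backIter h n (j + 1) y - backIter h n j y := by
  rw [backIter_eq_apply h hj]
  linarith [H.le j _ (H.backIter_mem n (j + 1) hy)]

theorem mul_backIter_nonneg (H : NearCritical δ ν h) (n j : ℕ) {y : ℝ}
    (hy : y ∈ Set.Icc (0 : ℝ) 1) : 0 ≤ δ j * backIter h n (j + 1) y :=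
  mul_nonneg (H.pos j).le (H.backIter_mem n (j + 1) hy).1

/-- Each weight is at most one step of the backward orbit, and the steps telescope inside `[0, 1]`.
-/
theorem sum_mul_backIter_le_one (H : NearCritical δ ν h) (n : ℕ) {y : ℝ}
    (hy : y ∈ Set.Icc (0 : ℝ) 1) :
    ∑ j ∈ Finset.range n, δ j * backIter h n (j + 1) y ≤ 1 := by
  calc ∑ j ∈ Finset.range n, δ j * backIter h n (j + 1) y
      ≤ ∑ j ∈ Finset.range n, (backIter h n (j + 1) y - backIter h n j y) :=
        Finset.sum_le_sum fun j hj => H.mul_backIter_le (Finset.mem_range.mp hj) hy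
    _ = backIter h n n y - backIter h n 0 y := Finset.sum_range_sub (fun j => backIter h n j y) n
    _ ≤ 1 := by linarith [(H.backIter_mem n n hy).2, (H.backIter_mem n 0 hy).1]

theorem monotone_backIter (H : NearCritical δ ν h) (n : ℕ) {y : ℝ} (hy : y ∈ Set.Icc (0 : ℝ) 1) :
    Monotone fun j => backIter h n j y := by
  refine monotone_nat_of_le_succ fun j => ?_
  rcases lt_or_ge j n with hj | hj
  · linarith [H.mul_backIter_le hj hy, H.mul_backIter_nonneg n j hy]
  · rw [backIter_of_le h hj, backIter_of_le h (hj.trans j.le_succ)]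

/-- The orbit increases with `j`, so its value at `j` times `∑_{j ≤ i < n} δ i` is at most the total
weight, hence at most `1`; the sum of the `δ i` diverges. -/
theorem tendsto_backIter (H : NearCritical δ ν h) (j : ℕ) {y : ℝ} (hy : y ∈ Set.Icc (0 : ℝ) 1) :
    Tendsto (fun n => backIter h n j y) atTop (𝓝 0) := by
  have hS : Tendsto (fun n => ∑ i ∈ Finset.range n, δ i - ∑ i ∈ Finset.range j, δ i) atTop atTop :=
    tendsto_atTop_add_const_right _ _ H.sum_tendsto
  refine squeeze_zero' (Eventually.of_forall fun n => (H.backIter_mem n j hy).1) ?_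
    hS.inv_tendsto_atTop
  filter_upwards [hS.eventually_gt_atTop 0, eventually_ge_atTop j] with n hn hjn
  rw [Pi.inv_apply, ← one_div, le_div_iff₀ hn]
  calc backIter h n j y * (∑ i ∈ Finset.range n, δ i - ∑ i ∈ Finset.range j, δ i)
      = ∑ i ∈ Finset.Ico j n, δ i * backIter h n j y := by
        rw [← Finset.sum_range_add_sum_Ico _ hjn, ← Finset.sum_mul]
        ring
    _ ≤ ∑ i ∈ Finset.Ico j n, δ i * backIter h n (i + 1) y := by
        refine Finset.sum_le_sum fun i hi => mul_le_mul_of_nonneg_left ?_ (H.pos i).le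
        exact H.monotone_backIter n hy (by have := (Finset.mem_Ico.mp hi).1; omega)
    _ ≤ ∑ i ∈ Finset.range n, δ i * backIter h n (i + 1) y :=
        Finset.sum_le_sum_of_subset_of_nonneg
          (fun i hi => Finset.mem_range.mpr (Finset.mem_Ico.mp hi).2)
          fun i _ _ => H.mul_backIter_nonneg n i hy
    _ ≤ 1 := H.sum_mul_backIter_le_one n hy

/-- The Toeplitz lemma with the weights `δ j * backIter h n (j + 1) y`. -/
theorem tendsto_sum_of_dominated (H : NearCritical δ ν h) {y : ℝ} (hy : y ∈ Set.Icc (0 : ℝ) 1)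
    {t : ℕ → ℕ → ℝ} {c : ℕ → ℝ} (hc : Tendsto c atTop (𝓝 0))
    (ht : ∀ j, Tendsto (fun n => t n j) atTop (𝓝 0))
    (hb : ∀ᶠ j in atTop, ∀ n, j < n → |t n j| ≤ c j * (δ j * backIter h n (j + 1) y)) :
    Tendsto (fun n => ∑ j ∈ Finset.range n, t n j) atTop (𝓝 0) :=
  tendsto_sum_range_of_dominated (fun n j _ => H.mul_backIter_nonneg n j hy)
    (fun n => H.sum_mul_backIter_le_one n hy) hc ht hb

theorem tendsto_limitPrimitive_backIter (H : NearCritical δ ν h) (k j : ℕ) {y : ℝ}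
    (hy : y ∈ Set.Icc (0 : ℝ) 1) :
    Tendsto (fun n => limitPrimitive ν k (backIter h n j y)) atTop (𝓝 0) := by
  have h0 := (hasDerivAt_limitPrimitive H.nonneg k le_rfl).continuousAt.tendsto
  rw [limitPrimitive_zero] at h0
  exact h0.comp (H.tendsto_backIter j hy)

/-- The increments of `limitPrimitive` along the orbit telescope to its value at `y`, up to the
vanishing value at the far end. To first order each increment is the corresponding summand, and the
Toeplitz lemma absorbs the errors. -/
theorem tendsto_sum_mul_backIter_pow (H : NearCritical δ ν h) (k : ℕ) {y : ℝ}
    (hy : y ∈ Set.Icc (0 : ℝ) 1) :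
    Tendsto (fun n => ∑ j ∈ Finset.range n, δ j * backIter h n (j + 1) y ^ (k + 1)) atTop
      (𝓝 (limitPrimitive ν k y)) := by
  obtain ⟨ρ, hρ, happ⟩ := H.approx
  obtain ⟨B, hB, htaylor⟩ := exists_limitPrimitive_taylor H.nonneg k
  have hν := H.nonneg
  have herr : Tendsto (fun n => ∑ j ∈ Finset.range n,
      (limitPrimitive ν k (backIter h n (j + 1) y) - limitPrimitive ν k (backIter h n j y) -
        δ j * backIter h n (j + 1) y ^ (k + 1))) atTop (𝓝 0) := by
    -- The first part of `c` is the quadratic Taylor error for a step of length at most `δ u (1 + ν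
    -- / 2 + ρ)`; the second is the error in the step itself.
    refine H.tendsto_sum_of_dominated hy
      (c := fun j => B * (δ j * (1 + ν / 2 + ρ j) ^ 2) + ρ j) ?_ (fun j => ?_) ?_
    · have := ((H.tendsto.mul ((hρ.const_add (1 + ν / 2)).pow 2)).const_mul B).add hρ
      simpa using this
    · have := ((H.tendsto_limitPrimitive_backIter k (j + 1) hy).sub
        (H.tendsto_limitPrimitive_backIter k j hy)).sub
        (((H.tendsto_backIter (j + 1) hy).pow (k + 1)).const_mul (δ j))
      simpa using this
    · filter_upwards [happ] with j hj n hjn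
      have hu := H.backIter_mem n (j + 1) hy
      have hu' := H.backIter_mem n j hy
      have hmono := H.monotone_backIter n hy j.le_succ
      simp only at hmono
      have hstep := hj _ hu
      rw [← backIter_eq_apply h hjn] at hstep
      have hT := htaylor _ _ hu'.1 hmono hu.2
      have hδ := H.pos j
      revert hu hu' hmono hstep hT
      generalize backIter h n (j + 1) y = u
      generalize backIter h n j y = u'
      intro hu hu' hmono hstep hT
      have hpos : 1 ≤ 1 + ν / 2 * u := by nlinarith [hu.1, mul_nonneg hν hu.1]
      have hψ0 : 0 ≤ u ^ k / (1 + ν / 2 * u) := div_nonneg (pow_nonneg hu.1 k) (by linarith)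
      have hψ1 : u ^ k / (1 + ν / 2 * u) ≤ 1 :=
        (div_le_self (pow_nonneg hu.1 k) hpos).trans (pow_le_one₀ hu.1 hu.2)
      -- The denominator of the integrand cancels the factor `1 + ν u / 2` in the orbit's step.
      have hψ : u ^ k / (1 + ν / 2 * u) * (δ j * (u + ν / 2 * u ^ 2)) = δ j * u ^ (k + 1) := by
        rw [div_mul_eq_mul_div, div_eq_iff (by linarith)]
        ring
      have hdiff : u - u' ≤ δ j * u * (1 + ν / 2 + ρ j) := by
        have h1 := (abs_le.mp hstep).2
        have h2 : δ j * (ν / 2 * u ^ 2) ≤ δ j * (ν / 2 * u) := by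
          gcongr
          nlinarith [hu.1, hu.2]
        nlinarith
      have hdu : 0 ≤ δ j * u := mul_nonneg hδ.le hu.1
      have hsq : (u - u') ^ 2 ≤ δ j * (1 + ν / 2 + ρ j) ^ 2 * (δ j * u) := by
        calc (u - u') ^ 2 ≤ (δ j * u * (1 + ν / 2 + ρ j)) ^ 2 :=
              pow_le_pow_left₀ (by linarith) hdiff 2
          _ = (δ j * (1 + ν / 2 + ρ j) ^ 2 * (δ j * u)) * u := by ring
          _ ≤ (δ j * (1 + ν / 2 + ρ j) ^ 2 * (δ j * u)) * 1 := by
              refine mul_le_mul_of_nonneg_left hu.2 ?_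
              have := mul_nonneg hδ.le (sq_nonneg (1 + ν / 2 + ρ j))
              exact mul_nonneg this hdu
          _ = _ := mul_one _
      have e : limitPrimitive ν k u - limitPrimitive ν k u' - δ j * u ^ (k + 1) =
          (limitPrimitive ν k u - limitPrimitive ν k u' - u ^ k / (1 + ν / 2 * u) * (u - u')) +
            u ^ k / (1 + ν / 2 * u) * (u - u' - δ j * (u + ν / 2 * u ^ 2)) := by
        rw [← hψ]; ring
      rw [e]
      refine (abs_add_le _ _).trans ?_
      rw [abs_mul, abs_of_nonneg hψ0]
      calc _ ≤ B * (u - u') ^ 2 + 1 * (ρ j * (δ j * u)) :=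
            add_le_add hT (mul_le_mul hψ1 hstep (abs_nonneg _) zero_le_one)
        _ ≤ B * (δ j * (1 + ν / 2 + ρ j) ^ 2 * (δ j * u)) + 1 * (ρ j * (δ j * u)) := by gcongr
        _ = _ := by ring
  have htel : Tendsto (fun n => limitPrimitive ν k y - limitPrimitive ν k (backIter h n 0 y)) atTop
      (𝓝 (limitPrimitive ν k y)) := by
    simpa using (H.tendsto_limitPrimitive_backIter k 0 hy).const_sub (limitPrimitive ν k y)
  have := htel.sub herr
  rw [sub_zero] at this
  refine this.congr fun n => ?_
  rw [Finset.sum_sub_distrib, Finset.sum_range_sub (fun j => limitPrimitive ν k (backIter h n j y)),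
    backIter_of_le h le_rfl]
  ring

theorem tendsto_sum_coeff_mul_backIter_pow (H : NearCritical δ ν h) (k : ℕ) {b : ℕ → ℝ} {l : ℝ}
    (hb : Tendsto (fun j => b j / δ j) atTop (𝓝 l)) {y : ℝ} (hy : y ∈ Set.Icc (0 : ℝ) 1) :
    Tendsto (fun n => ∑ j ∈ Finset.range n, b j * backIter h n (j + 1) y ^ (k + 1)) atTop
      (𝓝 (l * limitPrimitive ν k y)) := by
  have herr : Tendsto (fun n => ∑ j ∈ Finset.range n,
      (b j - l * δ j) * backIter h n (j + 1) y ^ (k + 1)) atTop (𝓝 0) := by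
    refine H.tendsto_sum_of_dominated hy (c := fun j => |b j / δ j - l|) ?_ (fun j => ?_)
      (Eventually.of_forall fun j n _ => ?_)
    · have := (hb.sub_const l).abs
      simpa using this
    · have := ((H.tendsto_backIter (j + 1) hy).pow (k + 1)).const_mul (b j - l * δ j)
      simpa using this
    · have hu := H.backIter_mem n (j + 1) hy
      have hδ := H.pos j
      have e : b j - l * δ j = (b j / δ j - l) * δ j := by field_simp
      rw [e, abs_mul, abs_mul, abs_of_pos hδ, abs_of_nonneg (pow_nonneg hu.1 _), mul_assoc]
      refine mul_le_mul_of_nonneg_left ?_ (abs_nonneg _)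
      exact mul_le_mul_of_nonneg_left (pow_le_of_le_one hu.1 hu.2 k.succ_ne_zero) hδ.le
  have := herr.add ((H.tendsto_sum_mul_backIter_pow k hy).const_mul l)
  rw [zero_add] at this
  refine this.congr fun n => ?_
  rw [Finset.mul_sum, ← Finset.sum_add_distrib]
  exact Finset.sum_congr rfl fun j _ => by ring

/-- If the `z j` are bracketed by their expansions with coefficients `b k j ~ l k * δ j`, then
`∑ z j (backIter h n (j + 1) y)` is asymptotically bracketed by the partial sums of
`∑ (-1) ^ k * l k * limitPrimitive ν k y`. -/
theorem exists_tendsto_bracket (H : NearCritical δ ν h) {z : ℕ → ℝ → ℝ} {b : ℕ → ℕ → ℝ}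
    {l : ℕ → ℝ} (hb : ∀ k, Tendsto (fun j => b k j / δ j) atTop (𝓝 (l k))) {y : ℝ}
    (hy : y ∈ Set.Icc (0 : ℝ) 1)
    (hz0 : ∀ j, Tendsto (fun n => z j (backIter h n (j + 1) y)) atTop (𝓝 0)) {K : ℕ}
    (hbr : ∀ᶠ j in atTop, ∀ u ∈ Set.Icc (0 : ℝ) 1,
      0 ≤ (-1) ^ (K + 1) * (∑ k ∈ Finset.range K, (-1) ^ k * b k j * u ^ (k + 1) - z j u)) :
    ∃ A : ℕ → ℝ,
      Tendsto A atTop (𝓝 (∑ k ∈ Finset.range K, (-1) ^ k * (l k * limitPrimitive ν k y))) ∧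
      ∀ᶠ n in atTop, 0 ≤ (-1) ^ (K + 1) *
        (A n - ∑ j ∈ Finset.range n, z j (backIter h n (j + 1) y)) := by
  obtain ⟨J, hJ⟩ := eventually_atTop.mp hbr
  set T : ℕ → ℝ → ℝ := fun j u => ∑ k ∈ Finset.range K, (-1) ^ k * b k j * u ^ (k + 1) with hT
  have hT0 : ∀ j, Tendsto (fun n => T j (backIter h n (j + 1) y)) atTop (𝓝 0) := fun j => by
    have := tendsto_finsetSum (Finset.range K) fun k _ =>
      ((H.tendsto_backIter (j + 1) hy).pow (k + 1)).const_mul ((-1) ^ k * b k j)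
    simpa [hT] using this
  -- The bracket may fail for `j < J`; there the truncation `T` is exchanged for `z` itself, which
  -- changes the sum by finitely many null sequences.
  refine ⟨fun n => ∑ j ∈ Finset.range n, T j (backIter h n (j + 1) y) +
    ∑ j ∈ Finset.range J, (z j (backIter h n (j + 1) y) - T j (backIter h n (j + 1) y)), ?_, ?_⟩
  · have h1 := tendsto_finsetSum (Finset.range K) fun k _ =>
      (H.tendsto_sum_coeff_mul_backIter_pow k (hb k) hy).const_mul ((-1) ^ k)
    have h2 := tendsto_finsetSum (Finset.range J) fun j _ => (hz0 j).sub (hT0 j)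
    have h3 := h1.add h2
    simp only [sub_zero, Finset.sum_const_zero, add_zero] at h3
    refine h3.congr fun n => ?_
    congr 1
    simp only [hT, Finset.mul_sum]
    rw [Finset.sum_comm]
    exact Finset.sum_congr rfl fun j _ => Finset.sum_congr rfl fun k _ => by ring
  · filter_upwards [eventually_ge_atTop J] with n hn
    rw [← Finset.sum_range_add_sum_Ico _ hn, ← Finset.sum_range_add_sum_Ico (fun j => z j _) hn,
      Finset.sum_sub_distrib]
    have e : ∀ a b c d : ℝ, a + b + (c - a) - (c + d) = b - d := fun _ _ _ _ => by ring
    rw [e, ← Finset.sum_sub_distrib, Finset.mul_sum]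
    exact Finset.sum_nonneg fun j hj =>
      hJ j (Finset.mem_Ico.mp hj).1 _ (H.backIter_mem n (j + 1) hy)

/-- A square is at most `(b j)² u`, that is, the weight `δ j * u` times `δ j * (b j / δ j) ^ 2`,
which tends to `0` with `δ j`. -/
theorem tendsto_sum_sq (H : NearCritical δ ν h) {z : ℕ → ℝ → ℝ} {b : ℕ → ℝ} {l : ℝ}
    (hb : Tendsto (fun j => b j / δ j) atTop (𝓝 l)) {y : ℝ} (hy : y ∈ Set.Icc (0 : ℝ) 1)
    (hz0 : ∀ j, Tendsto (fun n => z j (backIter h n (j + 1) y)) atTop (𝓝 0))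
    (hz : ∀ᶠ j in atTop, ∀ u ∈ Set.Icc (0 : ℝ) 1, 0 ≤ z j u ∧ z j u ≤ b j * u) :
    Tendsto (fun n => ∑ j ∈ Finset.range n, z j (backIter h n (j + 1) y) ^ 2) atTop (𝓝 0) := by
  refine H.tendsto_sum_of_dominated hy (c := fun j => δ j * (b j / δ j) ^ 2) ?_ (fun j => ?_) ?_
  · simpa using H.tendsto.mul (hb.pow 2)
  · simpa using (hz0 j).pow 2
  · filter_upwards [hz] with j hj n _
    have hu := H.backIter_mem n (j + 1) hy
    obtain ⟨h1, h2⟩ := hj _ hu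
    have hδ := H.pos j
    rw [abs_of_nonneg (sq_nonneg _)]
    calc z j (backIter h n (j + 1) y) ^ 2 ≤ (b j * backIter h n (j + 1) y) ^ 2 :=
          pow_le_pow_left₀ h1 h2 2
      _ = b j ^ 2 * backIter h n (j + 1) y * backIter h n (j + 1) y := by ring
      _ ≤ b j ^ 2 * backIter h n (j + 1) y * 1 :=
          mul_le_mul_of_nonneg_left hu.2 (mul_nonneg (sq_nonneg _) hu.1)
      _ = _ := by field_simp

end NearCritical

/-! ### Comparison of the product with an exponential -/

/-- A product of factors `1 - z` is compared with the exponential of `-∑ z`. -/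
theorem abs_prod_one_sub_sub_exp_le {ι : Type*} (A : Finset ι) {z : ι → ℝ}
    (hz : ∀ i ∈ A, z i ∈ Set.Icc (0 : ℝ) 1) :
    |∏ i ∈ A, (1 - z i) - Real.exp (-∑ i ∈ A, z i)| ≤ ∑ i ∈ A, z i ^ 2 := by
  classical
  induction A using Finset.induction_on with
  | empty => simp
  | insert i A hi ih =>
    have hzi := hz i (Finset.mem_insert_self i A)
    have ih := ih fun j hj => hz j (Finset.mem_insert_of_mem hj)
    rw [Finset.prod_insert hi, Finset.sum_insert hi, Finset.sum_insert hi, neg_add, Real.exp_add]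
    have hP : |1 - z i| ≤ 1 := abs_le.mpr ⟨by linarith [hzi.2], by linarith [hzi.1]⟩
    have hE : |Real.exp (-∑ j ∈ A, z j)| ≤ 1 := by
      rw [abs_of_pos (Real.exp_pos _), Real.exp_le_one_iff, neg_nonpos]
      exact Finset.sum_nonneg fun j hj => (hz j (Finset.mem_insert_of_mem hj)).1
    have h1 : |1 - z i - Real.exp (-z i)| ≤ z i ^ 2 := by
      have := Real.abs_exp_sub_one_sub_id_le (x := -z i) (by
        rw [abs_neg, abs_of_nonneg hzi.1]; exact hzi.2)
      rw [abs_sub_comm]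
      simpa [sub_eq_add_neg, add_assoc, add_comm] using this
    -- Exchange one factor at a time; everything multiplying the exchanged factor is at most `1` in
    -- absolute value.
    calc |(1 - z i) * ∏ j ∈ A, (1 - z j) - Real.exp (-z i) * Real.exp (-∑ j ∈ A, z j)|
        = |(1 - z i - Real.exp (-z i)) * Real.exp (-∑ j ∈ A, z j) +
            (1 - z i) * (∏ j ∈ A, (1 - z j) - Real.exp (-∑ j ∈ A, z j))| := by congr 1; ring
      _ ≤ |1 - z i - Real.exp (-z i)| * |Real.exp (-∑ j ∈ A, z j)| +
            |1 - z i| * |∏ j ∈ A, (1 - z j) - Real.exp (-∑ j ∈ A, z j)| := by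
          rw [← abs_mul, ← abs_mul]; exact abs_add_le _ _
      _ ≤ z i ^ 2 * 1 + 1 * ∑ j ∈ A, z j ^ 2 := by gcongr
      _ = _ := by ring

/-! ### From generating functions to convergence in distribution -/

theorem summable_mul_pow_of_abs_le {d : ℕ → ℝ} {C : ℝ} (hd : ∀ i, |d i| ≤ C) {s : ℝ}
    (hs : s ∈ Set.Ioo (0 : ℝ) 1) : Summable fun i => d i * s ^ i := by
  refine Summable.of_norm_bounded ((summable_geometric_of_lt_one hs.1.le hs.2).mul_left C)
    fun i => ?_
  rw [norm_mul, Real.norm_eq_abs, Real.norm_of_nonneg (pow_nonneg hs.1.le i)]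
  exact mul_le_mul_of_nonneg_right (hd i) (pow_nonneg hs.1.le i)

theorem abs_tsum_mul_pow_le {d : ℕ → ℝ} {C : ℝ} (hd : ∀ i, |d i| ≤ C) {s : ℝ}
    (hs : s ∈ Set.Ioo (0 : ℝ) 1) : |∑' i, d i * s ^ i| ≤ C * (1 - s)⁻¹ := by
  rw [← Real.norm_eq_abs]
  refine tsum_of_norm_bounded ((hasSum_geometric_of_lt_one hs.1.le hs.2).mul_left C) fun i => ?_
  rw [norm_mul, Real.norm_eq_abs, Real.norm_of_nonneg (pow_nonneg hs.1.le i)]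
  exact mul_le_mul_of_nonneg_right (hd i) (pow_nonneg hs.1.le i)

theorem tsum_mul_pow_eq_add {d : ℕ → ℝ} {C : ℝ} (hd : ∀ i, |d i| ≤ C) {s : ℝ}
    (hs : s ∈ Set.Ioo (0 : ℝ) 1) :
    ∑' i, d i * s ^ i = d 0 + s * ∑' i, d (i + 1) * s ^ i := by
  rw [(summable_mul_pow_of_abs_le hd hs).tsum_eq_zero_add, ← tsum_mul_left]
  simp only [pow_zero, mul_one]
  congr 2
  funext i
  ring

/-- The constant coefficient differs from the series at `s` by at most `s C / (1 - s)`, uniformly in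
`n`: fix a small `s`, then let `n` grow. -/
theorem tendsto_coeff_zero {d : ℕ → ℕ → ℝ} {C : ℝ} (hd : ∀ n i, |d n i| ≤ C)
    (hD : ∀ s ∈ Set.Ioo (0 : ℝ) 1, Tendsto (fun n => ∑' i, d n i * s ^ i) atTop (𝓝 0)) :
    Tendsto (fun n => d n 0) atTop (𝓝 0) := by
  have hC : 0 ≤ C := (abs_nonneg _).trans (hd 0 0)
  rw [Metric.tendsto_atTop]
  intro ε hε
  obtain ⟨s, hs, hsmall⟩ : ∃ s ∈ Set.Ioo (0 : ℝ) 1, s * (C * (1 - s)⁻¹) < ε / 2 := by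
    have hcont : ContinuousAt (fun s : ℝ => s * (C * (1 - s)⁻¹)) 0 := by
      refine continuousAt_id.mul (continuousAt_const.mul (ContinuousAt.inv₀ ?_ (by simp)))
      fun_prop
    have h1 : ∀ᶠ s in 𝓝[>] (0 : ℝ), s * (C * (1 - s)⁻¹) < ε / 2 :=
      (hcont.tendsto.eventually (gt_mem_nhds (by simpa using hε))).filter_mono nhdsWithin_le_nhds
    have h2 : ∀ᶠ s in 𝓝[>] (0 : ℝ), s ∈ Set.Ioo (0 : ℝ) 1 := Ioo_mem_nhdsGT one_pos
    obtain ⟨s, hs⟩ := (h1.and h2).exists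
    exact ⟨s, hs.2, hs.1⟩
  obtain ⟨M, hM⟩ := Metric.tendsto_atTop.mp (hD s hs) (ε / 2) (half_pos hε)
  refine ⟨M, fun n hn => ?_⟩
  have h1 := hM n hn
  rw [Real.dist_eq, sub_zero] at h1 ⊢
  have h2 := tsum_mul_pow_eq_add (hd n) hs
  have h3 := abs_tsum_mul_pow_le (d := fun i => d n (i + 1)) (fun i => hd n (i + 1)) hs
  have e : d n 0 = ∑' i, d n i * s ^ i - s * ∑' i, d n (i + 1) * s ^ i := by rw [h2]; ring
  rw [e]
  calc _ ≤ |∑' i, d n i * s ^ i| + |s * ∑' i, d n (i + 1) * s ^ i| := abs_sub _ _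
    _ ≤ |∑' i, d n i * s ^ i| + s * (C * (1 - s)⁻¹) := by
      rw [abs_mul, abs_of_pos hs.1]
      exact add_le_add le_rfl (mul_le_mul_of_nonneg_left h3 hs.1.le)
    _ < ε := by linarith

/-- Convergence of power series with bounded coefficients implies convergence of the
coefficients. -/
theorem tendsto_coeff {d : ℕ → ℕ → ℝ} {C : ℝ} (hd : ∀ n i, |d n i| ≤ C)
    (hD : ∀ s ∈ Set.Ioo (0 : ℝ) 1, Tendsto (fun n => ∑' i, d n i * s ^ i) atTop (𝓝 0)) (m : ℕ) :
    Tendsto (fun n => d n m) atTop (𝓝 0) := by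
  induction m generalizing d with
  | zero => exact tendsto_coeff_zero hd hD
  | succ m ih =>
    refine ih (d := fun n i => d n (i + 1)) (fun n i => hd n (i + 1)) fun s hs => ?_
    have h := ((hD s hs).sub (tendsto_coeff_zero hd hD)).div_const s
    rw [sub_zero, zero_div] at h
    refine h.congr fun n => ?_
    rw [tsum_mul_pow_eq_add (hd n) hs, add_sub_cancel_left, mul_div_cancel_left₀ _ hs.1.ne']

/-- Pointwise convergence of probability mass functions implies weak convergence. -/
theorem tendsto_probabilityMeasure_of_singleton {μs : ℕ → ProbabilityMeasure ℕ}
    {μ : ProbabilityMeasure ℕ}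
    (h : ∀ i, Tendsto (fun n => (μs n : Measure ℕ) {i}) atTop (𝓝 ((μ : Measure ℕ) {i}))) :
    Tendsto μs atTop (𝓝 μ) := by
  refine tendsto_of_forall_isOpen_le_liminf' fun G _ => ?_
  have e : ∀ κ : Measure ℕ, κ G = ∫⁻ i, G.indicator (fun i => κ {i}) i ∂Measure.count := fun κ => by
    rw [lintegral_count, Measure.tsum_indicator_apply_singleton _ _ MeasurableSet.of_discrete]
  simp only [e]
  -- Fatou's lemma for counting measure gives the portmanteau inequality on every set.
  refine le_trans (le_of_eq ?_) (lintegral_liminf_le fun n => measurable_of_countable _)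
  refine lintegral_congr fun i => ?_
  by_cases hi : i ∈ G
  · simp only [Set.indicator_of_mem hi]
    exact (h i).liminf_eq.symm
  · simp [Set.indicator_of_notMem hi]

theorem tendsto_probabilityMeasure_of_probGen {μs : ℕ → ProbabilityMeasure ℕ}
    {μ : ProbabilityMeasure ℕ}
    (h : ∀ s ∈ Set.Ioo (0 : ℝ) 1, Tendsto (fun n => ∫ y, s ^ y ∂(μs n : Measure ℕ)) atTop
      (𝓝 (∫ y, s ^ y ∂(μ : Measure ℕ)))) :
    Tendsto μs atTop (𝓝 μ) := by
  have hsum : ∀ (κ : ProbabilityMeasure ℕ), ∀ s ∈ Set.Ioo (0 : ℝ) 1,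
      HasSum (fun i => (κ : Measure ℕ).real {i} * s ^ i) (∫ y, s ^ y ∂(κ : Measure ℕ)) :=
    fun κ s hs => hasSum_probGen (P := (κ : Measure ℕ)) (X := id) measurable_id ⟨hs.1.le, hs.2.le⟩
  have hc := tendsto_coeff
    (d := fun n i => (μs n : Measure ℕ).real {i} - (μ : Measure ℕ).real {i}) (C := 1)
    (fun n i => by
      have h1 : (μs n : Measure ℕ).real {i} ≤ 1 := measureReal_le_one
      have h2 : (μ : Measure ℕ).real {i} ≤ 1 := measureReal_le_one
      have h3 : 0 ≤ (μs n : Measure ℕ).real {i} := measureReal_nonneg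
      have h4 : 0 ≤ (μ : Measure ℕ).real {i} := measureReal_nonneg
      rw [abs_le]
      constructor <;> linarith)
    (fun s hs => by
      have h1 := (h s hs).sub_const (∫ y, s ^ y ∂(μ : Measure ℕ))
      rw [sub_self] at h1
      refine h1.congr fun n => ?_
      simp only [sub_mul]
      exact (((hsum (μs n) s hs).sub (hsum μ s hs)).tsum_eq).symm)
  refine tendsto_probabilityMeasure_of_singleton fun i => ?_
  have h1 : Tendsto (fun n => (μs n : Measure ℕ).real {i}) atTop
      (𝓝 ((μ : Measure ℕ).real {i})) := by
    simpa using (hc i).add_const ((μ : Measure ℕ).real {i})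
  have h2 := (ENNReal.continuous_ofReal.tendsto _).comp h1
  simpa [Function.comp_def] using h2

/-! ### Compound Poisson laws and limits of their exponents -/

theorem probGen_poissonMeasure (r : ℝ≥0) (h : ℝ) :
    ∫ n, h ^ n ∂(poissonMeasure r) = Real.exp (-(r * (1 - h))) := by
  have h1 := (NormedSpace.expSeries_div_hasSum_exp ((r : ℝ) * h)).mul_left (Real.exp (-r))
  rw [← Real.exp_eq_exp_ℝ, ← Real.exp_add] at h1
  rw [integral_poissonMeasure]
  refine Eq.trans (tsum_congr fun n => ?_) (h1.tsum_eq.trans ?_)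
  · rw [smul_eq_mul, mul_pow]
    ring
  · congr 1
    ring

/-- The compound Poisson law with Lévy measure `∑ i, w i • δ_i`. -/
theorem exists_isCompoundPoisson {w : ℕ → ℝ} (hw : ∀ i, 0 ≤ w i) (hsum : Summable w)
    (hw0 : 0 < w 0) :
    ∃ μ : ProbabilityMeasure ℕ, IsCompoundPoisson (μ : Measure ℕ) ∧
      ∀ s ∈ Set.Icc (0 : ℝ) 1,
        ∫ y, s ^ y ∂(μ : Measure ℕ) = Real.exp (-∑' i, w i * (1 - s ^ i)) := by
  -- The mass at `0` does not affect the exponent, because `1 - s ^ 0 = 0`; its positivity only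
  -- serves to make `w` normalisable to a law for the `Z i`.
  have hσ : 0 < ∑' i, w i := hsum.tsum_pos hw 0 hw0
  set r : ℝ≥0 := ⟨∑' i, w i, hσ.le⟩ with hr
  have hrw : (r : ℝ) = ∑' i, w i := rfl
  have hp : HasSum (fun i => w i / ∑' i, w i) 1 := by
    have := hsum.hasSum.div_const (∑' i, w i)
    rwa [div_self hσ.ne'] at this
  have hp0 : ∀ i, 0 ≤ w i / ∑' i, w i := fun i => div_nonneg (hw i) hσ.le
  set κ : Measure ℕ := Measure.sum fun i => ENNReal.ofReal (w i / ∑' i, w i) • Measure.dirac i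
    with hκ
  have hκp : IsProbabilityMeasure κ := hp.isProbabilityMeasure_sum_dirac hp0
  have hκs : ∀ i, κ.real {i} = w i / ∑' i, w i := fun i => by
    rw [measureReal_def, hκ, Measure.sum_smul_dirac_singleton, ENNReal.toReal_ofReal (hp0 i)]
  have hlaw : ∀ o : Option ℕ, IsProbabilityMeasure
      (o.elim (poissonMeasure r) fun _ => κ : Measure ℕ) := by
    rintro (_ | i)
    · exact inferInstanceAs (IsProbabilityMeasure (poissonMeasure r))
    · exact hκp
  set Q : Measure (Option ℕ → ℕ) :=
    Measure.infinitePi fun o : Option ℕ => (o.elim (poissonMeasure r) fun _ => κ : Measure ℕ)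
    with hQ
  have hmeas : ∀ o : Option ℕ, Measurable fun ω : Option ℕ → ℕ => ω o := fun o =>
    measurable_pi_apply o
  have hind : iIndepFun (fun (o : Option ℕ) (ω : Option ℕ → ℕ) => ω o) Q :=
    iIndepFun_infinitePi (X := fun _ => id) fun _ => measurable_id
  have hmapN : Q.map (fun ω => ω none) = poissonMeasure r := Measure.infinitePi_map_eval _ none
  have hmapZ : ∀ i, Q.map (fun ω => ω (some i)) = κ := fun i =>
    Measure.infinitePi_map_eval _ (some i)
  have hmS : Measurable fun ω : Option ℕ → ℕ =>
      ∑ i ∈ Finset.range (ω none), ω (some i) :=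
    measurable_randomSum (hmeas none) fun i => hmeas (some i)
  refine ⟨⟨Q.map fun ω => ∑ i ∈ Finset.range (ω none), ω (some i),
    Measure.isProbabilityMeasure_map hmS.aemeasurable⟩, ?_, fun s hs => ?_⟩
  · refine ⟨Option ℕ → ℕ, inferInstance, Q, fun ω => ω none, fun i ω => ω (some i), r,
      inferInstance, hmeas none, fun i => hmeas (some i), ?_, fun i => ?_, hmapN, rfl⟩
    · convert hind using 1
      funext o
      rcases o with _ | i <;> rfl
    · exact ⟨(hmeas _).aemeasurable, (hmeas _).aemeasurable, by rw [hmapZ, hmapZ]⟩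
  · change ∫ y, s ^ y ∂(Q.map fun ω => ∑ i ∈ Finset.range (ω none), ω (some i)) = _
    rw [integral_map hmS.aemeasurable (measurable_of_countable _).aestronglyMeasurable]
    have hZ : ∀ i, probGen Q (fun ω => ω (some i)) s = ∫ y, s ^ y ∂κ := fun i => by
      rw [← hmapZ i, integral_map (hmeas _).aemeasurable
        (measurable_of_countable _).aestronglyMeasurable, probGen]
    have hκ1 : ∫ y, s ^ y ∂κ ∈ Set.Icc (0 : ℝ) 1 :=
      probGen_mem_Icc (P := κ) (X := id) measurable_id hs
    have hsumeq : ∀ (k : ℕ) (ω : Option ℕ → ℕ), ∑ j ∈ Finset.range k, ω (some j) + 0 =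
        ∑ o ∈ (Finset.range k).map Function.Embedding.some, ω o := fun k ω => by simp
    have hrs := probGen_randomSum (P := Q) (N := fun ω => ω none) (Z := fun i ω => ω (some i))
      (E := fun _ => 0) (g := 1) (hmeas none) (fun i => hmeas (some i)) measurable_const hs hκ1
      (fun k => by
        simp only [hsumeq]
        have := (hind.indepFun_finsetSum_of_notMem hmeas
          (s := (Finset.range k).map Function.Embedding.some) (i := none) (by simp)).symm
        convert this using 1
        funext ω
        simp)
      (fun k => by
        simp only [hsumeq]
        rw [probGen_sum hmeas hind, Finset.prod_map]
        simp [hZ])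
    simp only [add_zero, mul_one] at hrs
    have hN : probGen Q (fun ω => ω none) (∫ y, s ^ y ∂κ) =
        ∫ n, (∫ y, s ^ y ∂κ) ^ n ∂(poissonMeasure r) := by
      rw [← hmapN, integral_map (hmeas _).aemeasurable
        (measurable_of_countable _).aestronglyMeasurable, probGen]
    change probGen Q (fun ω => ∑ i ∈ Finset.range (ω none), ω (some i)) s = _
    rw [hrs, hN, probGen_poissonMeasure]
    congr 2
    have h1 := hasSum_probGen (P := κ) (X := id) measurable_id hs
    have h2 : HasSum (fun i => w i * s ^ i) (r * ∫ y, s ^ y ∂κ) := by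
      refine (h1.mul_left (r : ℝ)).congr_fun fun i => ?_
      rw [Set.preimage_id, hκs, hrw]
      field_simp
    have h3 := hsum.hasSum.sub h2
    rw [← hrw] at h3
    rw [mul_sub, mul_one, ← h3.tsum_eq]
    exact tsum_congr fun i => by ring

/-- A family of finite Lévy measures on `{1, 2, …}` with eventually bounded mass and Laplace
exponents that are small near `1` converges along every ultrafilter. -/
theorem exists_levy_limit (U : Ultrafilter ℕ) (hle : (U : Filter ℕ) ≤ atTop) {p : ℕ → ℕ → ℝ} (hp : ∀ n i, 0 ≤ p n i) {Q : ℕ → ℝ → ℝ}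
    (hQ : ∀ n, ∀ s ∈ Set.Icc (0 : ℝ) 1, HasSum (fun i => p n i * (1 - s ^ i)) (Q n s)) {C : ℝ}
    (hC : ∀ s ∈ Set.Icc (0 : ℝ) 1, ∀ η > 0, ∀ᶠ n in atTop, Q n s ≤ C * (1 - s) + η) :
    ∃ w : ℕ → ℝ, (∀ i, 0 ≤ w i) ∧ Summable w ∧ 0 < w 0 ∧ ∀ s ∈ Set.Icc (0 : ℝ) 1,
      Tendsto (fun n => Q n s) (U : Filter ℕ) (𝓝 (∑' i, w i * (1 - s ^ i))) := by
  have h0 : (0 : ℝ) ∈ Set.Icc (0 : ℝ) 1 := ⟨le_rfl, zero_le_one⟩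
  have hbound : ∀ᶠ n in (U : Filter ℕ), Q n 0 ≤ C + 1 := by
    simpa using (hC 0 h0 1 one_pos).filter_mono hle
  have hpw : ∀ i, ∀ s ∈ Set.Icc (0 : ℝ) 1, 0 ≤ 1 - s ^ i := fun i s hs =>
    sub_nonneg.mpr (pow_le_one₀ hs.1 hs.2)
  -- At `s = 0` the exponent is the total mass of `{1, 2, …}`, which is eventually at most `C + 1`;
  -- compactness then gives a limit for each atom.
  have hlim : ∀ i, ∃ x, 0 ≤ x ∧
      Tendsto (fun n => p n (i + 1)) (U : Filter ℕ) (𝓝 x) := fun i => by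
    obtain ⟨x, hx, hxl⟩ := (isCompact_Icc (a := (0 : ℝ)) (b := C + 1)).ultrafilter_le_nhds'
      (U.map fun n => p n (i + 1)) (by
        rw [Ultrafilter.mem_map]
        filter_upwards [hbound] with n hn
        refine ⟨hp _ _, le_trans ?_ hn⟩
        have := le_hasSum (hQ n 0 h0) (i + 1) fun j _ => mul_nonneg (hp n j) (hpw j 0 h0)
        simpa using this)
    exact ⟨x, hx.1, hxl⟩
  choose x hx0 hx using hlim
  have hsx : Summable x := by
    refine summable_of_sum_range_le (c := C + 1) hx0 fun M => ?_
    refine le_of_tendsto (tendsto_finsetSum (Finset.range M) fun i _ => hx i) ?_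
    filter_upwards [hbound] with n hn
    refine le_trans ?_ hn
    have := sum_le_hasSum ((Finset.range M).map (addRightEmbedding 1))
      (fun j _ => mul_nonneg (hp n j) (hpw j 0 h0)) (hQ n 0 h0)
    simpa using this
  -- The value `1` at `0` is arbitrary: that atom has weight `1 - s ^ 0 = 0`.
  set w : ℕ → ℝ := fun i => Nat.casesOn i 1 x with hw
  have hw0 : ∀ i, 0 ≤ w i := by
    rintro (_ | i)
    · exact zero_le_one
    · exact hx0 i
  have hsw : Summable w := (summable_nat_add_iff 1).mp hsx
  refine ⟨w, hw0, hsw, one_pos, fun s hs => ?_⟩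
  have hterm : ∀ i, Tendsto (fun n => p n i * (1 - s ^ i)) (U : Filter ℕ)
      (𝓝 (w i * (1 - s ^ i))) := by
    rintro (_ | i)
    · simp
    · exact (hx i).mul_const _
  have hsws : Summable fun i => w i * (1 - s ^ i) := by
    refine Summable.of_nonneg_of_le (fun i => mul_nonneg (hw0 i) (hpw i s hs)) (fun i => ?_) hsw
    exact mul_le_of_le_one_right (hw0 i) (by linarith [pow_nonneg hs.1 i])
  rw [Metric.tendsto_nhds]
  intro ε hε
  -- The point `t` controls the tail: it will give `Q n t < ε / 6`, and the tail beyond `M` is at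
  -- most twice that. Head, tail and truncation of the limit cost `ε / 3` each.
  obtain ⟨t, ht, htε⟩ : ∃ t ∈ Set.Ioo (0 : ℝ) 1, C * (1 - t) < ε / 12 := by
    have hcont : Tendsto (fun t : ℝ => C * (1 - t)) (𝓝[<] 1) (𝓝 0) := by
      have : Continuous fun t : ℝ => C * (1 - t) := by fun_prop
      have h := this.tendsto 1
      simp only [sub_self, mul_zero] at h
      exact h.mono_left nhdsWithin_le_nhds
    obtain ⟨t, ht⟩ := ((hcont.eventually (gt_mem_nhds (by positivity : 0 < ε / 12))).and
      (Ioo_mem_nhdsLT (one_pos : (0 : ℝ) < 1))).exists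
    exact ⟨t, ht.2, ht.1⟩
  obtain ⟨M, hM1, hM2⟩ : ∃ M : ℕ, t ^ M ≤ 1 / 2 ∧
      |∑ i ∈ Finset.range M, w i * (1 - s ^ i) - ∑' i, w i * (1 - s ^ i)| < ε / 3 := by
    have h1 := (tendsto_pow_atTop_nhds_zero_of_lt_one ht.1.le ht.2).eventually
      (ge_mem_nhds (by norm_num : (0 : ℝ) < 1 / 2))
    have h2 := (Metric.tendsto_nhds.mp hsws.hasSum.tendsto_sum_nat) (ε / 3) (by positivity)
    exact (h1.and h2).exists
  have hA := (Metric.tendsto_nhds.mp (tendsto_finsetSum (Finset.range M) fun i _ => hterm i))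
    (ε / 3) (by positivity)
  have htI : t ∈ Set.Icc (0 : ℝ) 1 := ⟨ht.1.le, ht.2.le⟩
  filter_upwards [hA, (hC t htI (ε / 12) (by positivity)).filter_mono hle] with n hn1 hn2
  have hlow : ∑ i ∈ Finset.range M, p n i * (1 - s ^ i) ≤ Q n s :=
    sum_le_hasSum _ (fun j _ => mul_nonneg (hp n j) (hpw j s hs)) (hQ n s hs)
  -- For `i ≥ M` one has `t ^ i ≤ 1 / 2`, so `1 - s ^ i ≤ 1 ≤ 2 * (1 - t ^ i)`.
  have hup : Q n s ≤ ∑ i ∈ Finset.range M, p n i * (1 - s ^ i) + 2 * Q n t := by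
    have hfin : HasSum (fun i => if i < M then p n i * (1 - s ^ i) else 0)
        (∑ i ∈ Finset.range M, p n i * (1 - s ^ i)) := by
      have h : HasSum (fun i => if i < M then p n i * (1 - s ^ i) else 0)
          (∑ i ∈ Finset.range M, if i < M then p n i * (1 - s ^ i) else 0) :=
        hasSum_sum_of_ne_finset_zero fun i hi => if_neg (by simpa using hi)
      rwa [Finset.sum_congr rfl fun i hi => if_pos (Finset.mem_range.mp hi)] at h
    refine hasSum_le (fun i => ?_) (hQ n s hs) (hfin.add ((hQ n t htI).mul_left 2))
    split_ifs with hi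
    · linarith [mul_nonneg (hp n i) (hpw i t htI)]
    · have h1 : t ^ i ≤ t ^ M := pow_le_pow_of_le_one ht.1.le ht.2.le (by omega)
      have h2 : 1 - s ^ i ≤ 2 * (1 - t ^ i) := by linarith [pow_nonneg hs.1 i]
      have := mul_le_mul_of_nonneg_left h2 (hp n i)
      linarith
  rw [Real.dist_eq] at hn1 ⊢
  rw [abs_lt] at hn1 hM2 ⊢
  constructor <;> linarith [hn1.1, hn1.2, hM2.1, hM2.2]

/-! ### Translating the hypotheses -/

/-- An infinite moment makes the quotient infinite, so a finite limit excludes it, but only for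
large `j`. -/
theorem toReal_div_tendsto {m : ℕ → ℝ≥0∞} {d : ℕ → ℝ} (hd : ∀ j, 0 < d j) {l : ℝ≥0}
    (h : Tendsto (fun j => m j / ENNReal.ofReal (d j)) atTop (𝓝 (l : ℝ≥0∞))) :
    (∀ᶠ j in atTop, m j ≠ ∞) ∧ Tendsto (fun j => (m j).toReal / d j) atTop (𝓝 (l : ℝ)) := by
  constructor
  · filter_upwards [h.eventually (gt_mem_nhds ENNReal.coe_lt_top)] with j hj hm
    rw [hm, ENNReal.top_div_of_ne_top ENNReal.ofReal_ne_top] at hj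
    exact lt_irrefl _ hj
  · have h1 := (ENNReal.tendsto_toReal ENNReal.coe_ne_top).comp h
    rw [ENNReal.coe_toReal] at h1
    refine h1.congr fun j => ?_
    rw [Function.comp_apply, ENNReal.toReal_div, ENNReal.toReal_ofReal (hd j).le]

theorem limitTerm_eq_limitPrimitive (ν : ℝ) (k : ℕ) (s : ℝ) :
    limitTerm ν (k + 1) s = (-1) ^ k * limitPrimitive ν k (1 - s) := by
  rw [limitPrimitive, ← mul_assoc, ← mul_pow, sub_sub_cancel]
  simp

theorem summable_mul_limitTerm {ν : ℝ} (hν : 0 ≤ ν) {lam : ℕ → ℝ≥0}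
    (hlam : limsup (fun n : ℕ => (lam n : ℝ≥0∞) ^ (1 / (n : ℝ))) atTop ≤ 1) {s : ℝ}
    (hs : s ∈ Set.Ioc (0 : ℝ) 1) :
    Summable fun k : ℕ => (lam (k + 1) : ℝ) * limitTerm ν (k + 1) s := by
  set y := 1 - s with hy
  have hy0 : 0 ≤ y := by linarith [hs.2]
  have hy1 : y < 1 := by linarith [hs.1]
  -- The reciprocal of the midpoint of `y` and `1`: `r > 1` allows the root bound `lam n ≤ r ^ n`,
  -- and `r * y < 1` gives a geometric majorant.
  set r : ℝ := 2 / (1 + y) with hr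
  have hr1 : 1 < r := by rw [hr, lt_div_iff₀ (by linarith)]; linarith
  have hry : r * y < 1 := by
    rw [hr, div_mul_eq_mul_div, div_lt_one (by linarith)]; linarith
  have hev : ∀ᶠ n : ℕ in atTop, (lam n : ℝ) ≤ r ^ n := by
    have h1 : limsup (fun n : ℕ => (lam n : ℝ≥0∞) ^ (1 / (n : ℝ))) atTop < ENNReal.ofReal r :=
      hlam.trans_lt (ENNReal.one_lt_ofReal.mpr hr1)
    filter_upwards [eventually_lt_of_limsup_lt h1, eventually_gt_atTop 0] with n hn hn0
    have h2 : ((lam n : ℝ≥0∞) ^ (1 / (n : ℝ))) ^ n ≤ ENNReal.ofReal r ^ n :=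
      pow_le_pow_left₀ zero_le hn.le n
    rw [← ENNReal.rpow_natCast, ← ENNReal.rpow_mul, one_div_mul_cancel (by positivity),
      ENNReal.rpow_one, ← ENNReal.ofReal_pow (by linarith)] at h2
    have h3 := ENNReal.toReal_mono ENNReal.ofReal_ne_top h2
    rwa [ENNReal.coe_toReal, ENNReal.toReal_ofReal (by positivity)] at h3
  have hry0 : 0 ≤ r * y := mul_nonneg (by linarith) hy0
  refine Summable.of_norm_bounded_eventually_nat
    (g := fun k => (r * y) * (r * y) ^ k) ((summable_geometric_of_lt_one hry0 hry).mul_left _) ?_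
  filter_upwards [(tendsto_add_atTop_nat 1).eventually hev] with k hk
  have hP := limitPrimitive_mem_Icc hν k hy0
  rw [limitTerm_eq_limitPrimitive, norm_mul, norm_mul, norm_pow, norm_neg, norm_one, one_pow,
    one_mul, Real.norm_of_nonneg (NNReal.coe_nonneg _), Real.norm_of_nonneg hP.1]
  calc (lam (k + 1) : ℝ) * limitPrimitive ν k y ≤ r ^ (k + 1) * y ^ (k + 1) :=
        mul_le_mul hk hP.2 hP.1 (by positivity)
    _ = r * y * (r * y) ^ k := by rw [← mul_pow, pow_succ']

/-- Brackets of alternating direction determine the limit. -/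
theorem eq_of_alternating_bracket {S : ℕ → ℝ} {q L : ℝ}
    (h : ∀ K, 0 ≤ (-1) ^ (K + 1) * (S K - q)) (hS : Tendsto S atTop (𝓝 L)) : q = L := by
  -- Consecutive deviations have opposite signs, so their product is nonpositive, while it tends to
  -- `(L - q) ^ 2`.
  have h1 : ∀ K, (S K - q) * (S (K + 1) - q) ≤ 0 := fun K => by
    have := mul_nonneg (h K) (h (K + 1))
    have e : (-1 : ℝ) ^ (K + 1) * (S K - q) * ((-1) ^ (K + 1 + 1) * (S (K + 1) - q)) =
        -(((-1) ^ (K + 1) * (-1) ^ (K + 1)) * ((S K - q) * (S (K + 1) - q))) := by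
      rw [pow_succ _ (K + 1)]
      ring
    rw [e, ← mul_pow] at this
    simp at this
    exact this
  have h2 : Tendsto (fun K => (S K - q) * (S (K + 1) - q)) atTop (𝓝 ((L - q) * (L - q))) :=
    (hS.sub_const q).mul (((tendsto_add_atTop_iff_nat 1).mpr hS).sub_const q)
  have h3 := le_of_tendsto' h2 h1
  have h4 : L - q = 0 := mul_self_eq_zero.mp (le_antisymm h3 (mul_self_nonneg _))
  linarith

section Prob

variable {Ω : Type*} [MeasurableSpace Ω] {P : Measure Ω}

theorem coGen_le [IsProbabilityMeasure P] {X : Ω → ℕ} (hX : Measurable X)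
    (h1 : factorialMoment P X 1 ≠ ∞) {u : ℝ} (hu : u ∈ Set.Icc (0 : ℝ) 1) :
    coGen P X u ≤ (factorialMoment P X 1).toReal * u := by
  have := bonferroni_coGen hX 1 (fun k hk => by
    rw [Nat.lt_one_iff] at hk; rwa [hk]) hu
  simp at this
  exact this

theorem le_coGen [IsProbabilityMeasure P] {X : Ω → ℕ} (hX : Measurable X)
    (h1 : factorialMoment P X 1 ≠ ∞) (h2 : factorialMoment P X 2 ≠ ∞) {u : ℝ}
    (hu : u ∈ Set.Icc (0 : ℝ) 1) :
    (factorialMoment P X 1).toReal * u - (factorialMoment P X 2).toReal / 2 * u ^ 2 ≤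
      coGen P X u := by
  have := bonferroni_coGen hX 2 (fun k hk => by interval_cases k <;> assumption) hu
  simp [Finset.sum_range_succ, Nat.factorial] at this
  linarith

theorem coGen_le_of_third [IsProbabilityMeasure P] {X : Ω → ℕ} (hX : Measurable X)
    (h1 : factorialMoment P X 1 ≠ ∞) (h2 : factorialMoment P X 2 ≠ ∞)
    (h3 : factorialMoment P X 3 ≠ ∞) {u : ℝ} (hu : u ∈ Set.Icc (0 : ℝ) 1) :
    coGen P X u ≤ (factorialMoment P X 1).toReal * u - (factorialMoment P X 2).toReal / 2 * u ^ 2 +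
      (factorialMoment P X 3).toReal / 6 * u ^ 3 := by
  have := bonferroni_coGen hX 3 (fun k hk => by interval_cases k <;> assumption) hu
  simp [Finset.sum_range_succ, Nat.factorial] at this
  norm_num at this
  linarith

theorem nearCritical_coGen [IsProbabilityMeasure P] {X : ℕ → Ω → ℕ} (hX : ∀ n, Measurable (X n))
    {fbar : ℕ → ℝ≥0∞} (hf : ∀ n, fbar n = factorialMoment P (X n) 1) (hlt : ∀ n, fbar n < 1)
    (hlim : Tendsto fbar atTop (𝓝 1)) (hsum : ∑' n, (1 - fbar n) = ∞) (ν : ℝ≥0)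
    (hC2 : Tendsto (fun n => factorialMoment P (X n) 2 / (1 - fbar n)) atTop (𝓝 (ν : ℝ≥0∞)))
    (hC3 : 0 < ν → Tendsto (fun n => factorialMoment P (X n) 3 / (1 - fbar n)) atTop (𝓝 0)) :
    NearCritical (fun n => 1 - (fbar n).toReal) ν (fun n => coGen P (X n)) := by
  have htop : ∀ n, fbar n ≠ ∞ := fun n => ((hlt n).trans ENNReal.one_lt_top).ne
  have hm1 : ∀ n, factorialMoment P (X n) 1 ≠ ∞ := fun n => hf n ▸ htop n
  have hpos : ∀ n, 0 < 1 - (fbar n).toReal := fun n => by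
    have := (ENNReal.toReal_lt_toReal (htop n) ENNReal.one_ne_top).mpr (hlt n)
    rw [ENNReal.toReal_one] at this
    linarith
  have hsub : ∀ n, 1 - fbar n = ENNReal.ofReal (1 - (fbar n).toReal) := fun n => by
    rw [ENNReal.ofReal_sub _ ENNReal.toReal_nonneg, ENNReal.ofReal_one,
      ENNReal.ofReal_toReal (htop n)]
  simp only [hsub] at hsum hC2 hC3
  obtain ⟨hm2, hr2⟩ := toReal_div_tendsto hpos hC2
  refine ⟨ν.2, hpos, ?_, ?_, fun n u hu => coGen_mem_Icc (hX n) hu, fun n u hu => ?_, ?_⟩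
  · have := ((ENNReal.tendsto_toReal ENNReal.one_ne_top).comp hlim).const_sub 1
    simpa [Function.comp_def] using this
  · rw [← not_summable_iff_tendsto_nat_atTop_of_nonneg fun n => (hpos n).le]
    exact fun h => h.tsum_ofReal_ne_top hsum
  · have := coGen_le (hX n) (hm1 n) hu
    rwa [← hf, ← sub_sub_cancel 1 (fbar n).toReal] at this
  · have hr2' : Tendsto (fun n => |(factorialMoment P (X n) 2).toReal / (1 - (fbar n).toReal) - ν|)
        atTop (𝓝 0) := by
      have := (hr2.sub_const (ν : ℝ)).abs
      simpa using this
    -- For `ν = 0` the second moment is itself the error term, so two brackets suffice. For `ν > 0`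
    -- it is a main term and the third moment bounds the error.
    rcases (zero_le : 0 ≤ ν).eq_or_lt with h0 | h0
    · refine ⟨_, hr2', ?_⟩
      filter_upwards [hm2] with n hn u hu
      have i1 := coGen_le (hX n) (hm1 n) hu
      have i2 := le_coGen (hX n) (hm1 n) hn hu
      rw [← hf] at i1 i2
      rw [← h0, NNReal.coe_zero, sub_zero, zero_div, zero_mul, add_zero,
        abs_of_nonneg (div_nonneg ENNReal.toReal_nonneg (hpos n).le), ← mul_assoc,
        div_mul_cancel₀ _ (hpos n).ne', abs_le]
      have hM : 0 ≤ (factorialMoment P (X n) 2).toReal := ENNReal.toReal_nonneg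
      have hMu := mul_nonneg hM hu.1
      have hu2 : (factorialMoment P (X n) 2).toReal * u ^ 2 ≤
          (factorialMoment P (X n) 2).toReal * u :=
        mul_le_mul_of_nonneg_left (pow_le_of_le_one hu.1 hu.2 two_ne_zero) hM
      constructor <;> linarith
    · obtain ⟨hm3, hr3⟩ := toReal_div_tendsto (l := 0) hpos (by simpa using hC3 h0)
      refine ⟨_, by simpa using hr2'.add hr3, ?_⟩
      filter_upwards [hm2, hm3] with n hn2 hn3 u hu
      have i2 := le_coGen (hX n) (hm1 n) hn2 hu
      have i3 := coGen_le_of_third (hX n) (hm1 n) hn2 hn3 hu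
      rw [← hf] at i2 i3
      have hδ := hpos n
      revert i2 i3 hδ
      have hM3 : 0 ≤ (factorialMoment P (X n) 3).toReal := ENNReal.toReal_nonneg
      revert hM3
      generalize (factorialMoment P (X n) 3).toReal = M3
      generalize (factorialMoment P (X n) 2).toReal = M2
      generalize (fbar n).toReal = f
      generalize coGen P (X n) u = c
      intro hM3 i2 i3 hδ
      have e1 : (|M2 / (1 - f) - ν| + M3 / (1 - f)) * ((1 - f) * u) =
          |M2 - ν * (1 - f)| * u + M3 * u := by
        have : M2 / (1 - f) - ν = (M2 - ν * (1 - f)) / (1 - f) := by field_simp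
        rw [this, abs_div, abs_of_pos hδ]
        field_simp
      have e2 : u - c - (1 - f) * (u + ν / 2 * u ^ 2) =
          (f * u - M2 / 2 * u ^ 2 - c) + (M2 - ν * (1 - f)) * (u ^ 2 / 2) := by ring
      have hu2 : u ^ 2 ≤ u := pow_le_of_le_one hu.1 hu.2 two_ne_zero
      have hu3 : u ^ 3 ≤ u := pow_le_of_le_one hu.1 hu.2 three_ne_zero
      rw [e1, e2]
      refine (abs_add_le _ _).trans ?_
      rw [add_comm, abs_mul, abs_of_nonneg (by positivity : 0 ≤ u ^ 2 / 2)]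
      refine add_le_add (mul_le_mul_of_nonneg_left (by linarith [hu.1]) (abs_nonneg _)) ?_
      have := mul_le_mul_of_nonneg_left hu3 hM3
      have := mul_nonneg hM3 hu.1
      have := mul_nonneg hM3 (pow_nonneg hu.1 3)
      rw [abs_le]
      constructor <;> linarith

theorem hasSum_one_sub_probGen [IsProbabilityMeasure P] {X : Ω → ℕ} (hX : Measurable X) {s : ℝ}
    (hs : s ∈ Set.Icc (0 : ℝ) 1) :
    HasSum (fun i => P.real (X ⁻¹' {i}) * (1 - s ^ i)) (1 - probGen P X s) :=
  ((hasSum_measureReal_fiber hX).sub (hasSum_probGen hX hs)).congr_fun fun i => by ring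

end Prob

/-! ### Assembly of the limit theorem -/

theorem theorem3 {Ω : Type*} [MeasurableSpace Ω] (P : Measure Ω) [IsProbabilityMeasure P]
    (ξ : ℕ → ℕ → Ω → ℕ) (ε : ℕ → Ω → ℕ)
    (hξ : ∀ n j, Measurable (ξ n j)) (hε : ∀ n, Measurable (ε n))
    (hindep : iIndepFun (Sum.elim (fun p : ℕ × ℕ => ξ p.1 p.2) ε) P)
    (hident : ∀ n j, IdentDistrib (ξ n j) (ξ n 0) P P)
    -- `fbar n` is the offspring mean
    (fbar : ℕ → ℝ≥0∞) (hf : ∀ n, fbar n = factorialMoment P (ξ n 0) 1)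
    -- the process is nearly critical
    (hC1_lt : ∀ n, fbar n < 1)
    (hC1_lim : Tendsto fbar atTop (𝓝 1))
    (hC1_sum : ∑' n, (1 - fbar n) = ∞)
    -- second factorial moments of the offspring
    (ν : ℝ≥0)
    (hC2 : Tendsto (fun n => factorialMoment P (ξ n 0) 2 / (1 - fbar n)) atTop (𝓝 (ν : ℝ≥0∞)))
    -- third factorial moments of the offspring
    (hC3 : 0 < ν → Tendsto (fun n => factorialMoment P (ξ n 0) 3 / (1 - fbar n)) atTop (𝓝 0))
    -- factorial moments of the immigration
    (lam : ℕ → ℝ≥0)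
    (hC4_lim : ∀ k, 1 ≤ k →
      Tendsto (fun n => factorialMoment P (ε n) k / ((k.factorial : ℝ≥0∞) * (1 - fbar n))) atTop
        (𝓝 (lam k : ℝ≥0∞)))
    (hC4_limsup : limsup (fun n : ℕ => (lam n : ℝ≥0∞) ^ (1 / (n : ℝ))) atTop ≤ 1) :
    ∃ μ : ProbabilityMeasure ℕ,
      -- convergence in distribution to a random variable with law `μ`
      TendstoInDistribution (branchingImmigration ξ ε) atTop (id : ℕ → ℕ) (fun _ => P)
        (μ : Measure ℕ) ∧
      IsCompoundPoisson (μ : Measure ℕ) ∧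
      -- the series converges absolutely for `0 < s ≤ 1`
      (∀ s ∈ Set.Ioc (0 : ℝ) 1,
        Summable (fun k : ℕ => (lam (k + 1) : ℝ) * limitTerm ν (k + 1) s)) ∧
      -- the generating function of the limit, wherever the series converges in `[0, 1]`
      (∀ s ∈ Set.Icc (0 : ℝ) 1, ∀ L : ℝ,
        Tendsto (fun K : ℕ => ∑ k ∈ Finset.range K,
          (lam (k + 1) : ℝ) * limitTerm ν (k + 1) s) atTop (𝓝 L) →
        ∫ y, s ^ y ∂(μ : Measure ℕ) = Real.exp (-L)) := by
  have H := nearCritical_coGen (fun n => hξ n 0) hf hC1_lt hC1_lim hC1_sum ν hC2 hC3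
  set δ : ℕ → ℝ := fun n => 1 - (fbar n).toReal with hδ
  set h : ℕ → ℝ → ℝ := fun n => coGen P (ξ n 0) with hh
  have hsub : ∀ n, 1 - fbar n = ENNReal.ofReal (δ n) := fun n => by
    rw [hδ, ENNReal.ofReal_sub _ ENNReal.toReal_nonneg, ENNReal.ofReal_one,
      ENNReal.ofReal_toReal ((hC1_lt n).trans ENNReal.one_lt_top).ne]
  have himm : ∀ k, (∀ᶠ j in atTop, factorialMoment P (ε j) (k + 1) ≠ ∞) ∧
      Tendsto (fun j => (factorialMoment P (ε j) (k + 1)).toReal / ((k + 1).factorial : ℝ) / δ j)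
        atTop (𝓝 (lam (k + 1) : ℝ)) := fun k => by
    have h1 := toReal_div_tendsto (m := fun j => factorialMoment P (ε j) (k + 1))
      (d := fun j => ((k + 1).factorial : ℝ) * δ j) (l := lam (k + 1))
      (fun j => mul_pos (by exact_mod_cast (k + 1).factorial_pos) (H.pos j)) (by
        refine (hC4_lim (k + 1) k.succ_pos).congr fun j => ?_
        rw [hsub, ENNReal.ofReal_mul (Nat.cast_nonneg _), ENNReal.ofReal_natCast])
    refine ⟨h1.1, h1.2.congr fun j => by rw [div_div]⟩
  have hy : ∀ s ∈ Set.Icc (0 : ℝ) 1, 1 - s ∈ Set.Icc (0 : ℝ) 1 := fun s hs =>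
    ⟨by linarith [hs.2], by linarith [hs.1]⟩
  set z : ℕ → ℝ → ℝ := fun j => coGen P (ε j) with hz
  set Q : ℕ → ℝ → ℝ := fun n s => ∑ j ∈ Finset.range n, z j (backIter h n (j + 1) (1 - s)) with hQ
  set S : ℝ → ℕ → ℝ := fun s K =>
    ∑ k ∈ Finset.range K, (lam (k + 1) : ℝ) * limitTerm ν (k + 1) s with hS
  have hz0 : ∀ s ∈ Set.Icc (0 : ℝ) 1, ∀ j,
      Tendsto (fun n => z j (backIter h n (j + 1) (1 - s))) atTop (𝓝 0) := fun s hs j =>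
    tendsto_coGen_zero (hε j) (fun n => H.backIter_mem n (j + 1) (hy s hs))
      (H.tendsto_backIter (j + 1) (hy s hs))
  have hbr : ∀ s ∈ Set.Icc (0 : ℝ) 1, ∀ K, ∃ A : ℕ → ℝ, Tendsto A atTop (𝓝 (S s K)) ∧
      ∀ᶠ n in atTop, 0 ≤ (-1) ^ (K + 1) * (A n - Q n s) := fun s hs K => by
    have h1 := H.exists_tendsto_bracket (fun k => (himm k).2) (hy s hs) (hz0 s hs) (K := K) (by
      filter_upwards [(eventually_all_finset (Finset.range K)).mpr fun k _ => (himm k).1]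
        with j hj u hu
      exact bonferroni_coGen (hε j) K (fun k hk => hj k (Finset.mem_range.mpr hk)) hu)
    convert h1 using 5
    simp only [hS]
    refine Finset.sum_congr rfl fun k _ => ?_
    rw [limitTerm_eq_limitPrimitive]
    ring
  -- Stated along ultrafilters because convergence of `Q n s` is not yet known; wherever the series
  -- converges, its sum is the only possible limit.
  have hunique : ∀ s ∈ Set.Icc (0 : ℝ) 1, ∀ U : Ultrafilter ℕ, (U : Filter ℕ) ≤ atTop →
      ∀ q L : ℝ, Tendsto (fun n => Q n s) U (𝓝 q) → Tendsto (S s) atTop (𝓝 L) → q = L := by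
    intro s hs U hU q L hq hL
    refine eq_of_alternating_bracket (fun K => ?_) hL
    obtain ⟨A, hA, hAQ⟩ := hbr s hs K
    exact ge_of_tendsto (((hA.mono_left hU).sub hq).const_mul _) (hAQ.filter_mono hU)
  -- The bracket with `K = 1` is an upper bound, and it involves only the mean immigration.
  have hbound : ∀ s ∈ Set.Icc (0 : ℝ) 1, ∀ η > 0, ∀ᶠ n in atTop,
      Q n s ≤ (lam 1 : ℝ) * (1 - s) + η := by
    intro s hs η hη
    obtain ⟨A, hA, hAQ⟩ := hbr s hs 1
    have h1 : S s 1 ≤ (lam 1 : ℝ) * (1 - s) := by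
      have := (limitPrimitive_mem_Icc ν.2 0 (hy s hs).1).2
      simp only [hS, Finset.sum_range_one, limitTerm_eq_limitPrimitive, pow_zero, one_mul]
      refine mul_le_mul_of_nonneg_left ?_ (NNReal.coe_nonneg _)
      simpa using this
    filter_upwards [hAQ, hA.eventually (gt_mem_nhds (lt_add_of_pos_right _ hη))] with n hn1 hn2
    simp at hn1
    linarith
  -- The laws at time `n` of the progeny of each immigration generation, added up: this is the Lévy
  -- measure behind `Q n`.
  set p : ℕ → ℕ → ℝ := fun n i => ∑ j ∈ Finset.range n,
    P.real (branchingImmigration ξ (fun m ω => if m = j then ε m ω else 0) n ⁻¹' {i}) with hp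
  have hpQ : ∀ n, ∀ s ∈ Set.Icc (0 : ℝ) 1, HasSum (fun i => p n i * (1 - s ^ i)) (Q n s) := by
    intro n s hs
    simp only [hp, hQ, Finset.sum_mul]
    refine hasSum_sum fun j hj => ?_
    have hm : Measurable (branchingImmigration ξ (fun m ω => if m = j then ε m ω else 0) n) :=
      measurable_branchingImmigration hξ (fun m => by
        split_ifs
        exacts [hε m, measurable_const]) n
    have h1 := hasSum_one_sub_probGen (P := P) hm hs
    have h2 := probGen_branchingImmigration_single hξ hε hindep hident (Finset.mem_range.mp hj)
      (hy s hs)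
    rw [sub_sub_cancel] at h2
    rwa [h2, sub_sub_cancel] at h1
  have hlevy := fun (U : Ultrafilter ℕ) (hU : (U : Filter ℕ) ≤ atTop) =>
    exists_levy_limit U hU (fun n i => Finset.sum_nonneg fun j _ => measureReal_nonneg) hpQ hbound
  -- Any one ultrafilter suffices to produce the limit law. Its generating function is identified by
  -- `hunique`, including at `s = 0` if the series converges there.
  obtain ⟨w, hw, hws, hw0, hwQ⟩ := hlevy (hyperfilter ℕ) Nat.hyperfilter_le_atTop
  obtain ⟨μ, hμ, hμgen⟩ := exists_isCompoundPoisson hw hws hw0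
  have hgen : ∀ s ∈ Set.Icc (0 : ℝ) 1, ∀ L : ℝ, Tendsto (S s) atTop (𝓝 L) →
      ∫ y, s ^ y ∂(μ : Measure ℕ) = Real.exp (-L) := by
    intro s hs L hL
    rw [hμgen s hs, hunique s hs _ Nat.hyperfilter_le_atTop _ L (hwQ s hs) hL]
  have hsum : ∀ s ∈ Set.Ioc (0 : ℝ) 1,
      Summable (fun k : ℕ => (lam (k + 1) : ℝ) * limitTerm ν (k + 1) s) := fun s hs =>
    summable_mul_limitTerm ν.2 hC4_limsup hs
  have hmeas := measurable_branchingImmigration hξ hε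
  refine ⟨μ, ⟨fun n => (hmeas n).aemeasurable, measurable_id.aemeasurable, ?_⟩, hμ, hsum, hgen⟩
  refine tendsto_probabilityMeasure_of_probGen fun s hs => ?_
  have hsI : s ∈ Set.Icc (0 : ℝ) 1 := ⟨hs.1.le, hs.2.le⟩
  have hL := (hsum s ⟨hs.1, hs.2.le⟩).hasSum.tendsto_sum_nat
  have hQL : Tendsto (fun n => Q n s) atTop
      (𝓝 (∑' k : ℕ, (lam (k + 1) : ℝ) * limitTerm ν (k + 1) s)) := by
    -- Along each ultrafilter a limit exists by compactness, and it must be the sum of the series.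
    rw [tendsto_iff_ultrafilter]
    intro U hU
    obtain ⟨w', -, -, -, hw'⟩ := hlevy U hU
    rw [← hunique s hsI U hU _ _ (hw' s hsI) hL]
    exact hw' s hsI
  have hsq := H.tendsto_sum_sq (himm 0).2 (hy s hsI) (hz0 s hsI) (by
    filter_upwards [(himm 0).1] with j hj u hu
    exact ⟨(coGen_mem_Icc (hε j) hu).1, by simpa using coGen_le (hε j) hj hu⟩)
  have hdiff : Tendsto (fun n => probGen P (branchingImmigration ξ ε n) s - Real.exp (-Q n s)) atTop
      (𝓝 0) := by
    refine squeeze_zero_norm (fun n => ?_) hsq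
    have h1 := probGen_branchingImmigration hξ hε hindep hident n (hy s hsI)
    rw [sub_sub_cancel] at h1
    rw [h1, Real.norm_eq_abs]
    exact abs_prod_one_sub_sub_exp_le _ fun j _ =>
      coGen_mem_Icc (hε j) (H.backIter_mem n (j + 1) (hy s hsI))
  have hlim := hdiff.add ((Real.continuous_exp.tendsto _).comp hQL.neg)
  rw [zero_add, ← hgen s hsI _ hL] at hlim
  simp only [ProbabilityMeasure.coe_mk, Measure.map_id]
  refine hlim.congr fun n => ?_
  rw [integral_map (hmeas n).aemeasurable (measurable_of_countable _).aestronglyMeasurable]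
  simp [probGen]
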